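/- For $1\le p<\infty$ let $\mathcal H^p$ be the completion of the space of Dirichlet polynomials $P(s)=\sum_{n\le N}a_n n^{-s}$ with respect to the norm $$\|P\|_{\mathcal H^p}=\Big(\lim_{T\to\infty}\frac1T\int_0^T|P(it)|^p\,dt\Big)^{1/p}.$$ The coefficient functionals $P\mapsto a_n$ extend continuously to $\mathcal H^p$, and every $f\in\mathcal H^p$ is identified with its Dirichlet series $f(s)=\sum_{n\ge1}a_n n^{-s}$, $\operatorname{Re}s>1/2$. Let $\mathcal H^p_0$ be the subspace of those $f\in\mathcal H^p$ with $a_1=0$, that is, of the series $\sum_{n\ge2}a_n n^{-s}$, which vanish at $+\infty$. Let $$\mathbf Hf(s)=\int_{1/2}^{+\infty}f(w)\,(\zeta(w+s)-1)\,dw,\qquad \operatorname{Re}s>1/2,$$ where $\zeta$ is the Riemann zeta function; the integral converges absolutely for every Dirichlet polynomial $f\in\mathcal H^p_0$. **Theorem.** If $1\le p<\infty$ and $p\ne2$, then $\mathbf H$ does not act boundedly on $\mathcal H^p_0$: there is no bounded linear operator $T:\mathcal H^p_0\to\mathcal H^p_0$ such that $(Tf)(s)=\mathbf Hf(s)$ for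 all Dirichlet polynomials $f\in\mathcal H^p_0$ and all $s$ with $\operatorname{Re}s>1/2$. -/

import Mathlib

open Filter MeasureTheory Topology

noncomputable section

/-! ### Dirichlet polynomials and mean values along the imaginary axis -/

/-- The Dirichlet polynomial `∑ aₙ n^{-s}` with finitely many nonzero coefficients `aₙ`, `n ≥ 1`. -/
def dirEval (a : ℕ+ →₀ ℂ) (s : ℂ) : ℂ := a.sum fun n c => c * ((n : ℕ) : ℂ) ^ (-s)

/-- The mean of `|P(it)|^p` over `0 ≤ t ≤ T`. -/
def dirMean (p : ℝ) (a : ℕ+ →₀ ℂ) (T : ℝ) : ℝ :=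
  (1 / T) * ∫ t in (0 : ℝ)..T, ‖dirEval a ((t : ℂ) * Complex.I)‖ ^ p

/-- `‖P‖ = (lim_{T → ∞} (1/T) ∫_0^T |P(it)|^p dt)^{1/p}`; the limit exists by
`tendsto_dirMean` below. -/
def dirNorm (p : ℝ) (a : ℕ+ →₀ ℂ) : ℝ := (limUnder atTop (dirMean p a)) ^ (1 / p)

lemma dirEval_add (a b : ℕ+ →₀ ℂ) (s : ℂ) : dirEval (a + b) s = dirEval a s + dirEval b s := by
  unfold dirEval
  exact Finsupp.sum_add_index' (by simp) (by intros; ring)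

lemma dirEval_smul (c : ℂ) (a : ℕ+ →₀ ℂ) (s : ℂ) : dirEval (c • a) s = c * dirEval a s := by
  unfold dirEval
  rw [Finsupp.sum_smul_index' (by simp), Finsupp.sum, Finsupp.sum, Finset.mul_sum]
  exact Finset.sum_congr rfl fun n _ => by simp [mul_assoc]

/-- The exponential `t ↦ e^{iλt}`. -/
def meanExp (l : ℝ) (t : ℝ) : ℂ := Complex.exp ((l : ℂ) * (t : ℂ) * Complex.I)

/-- Trigonometric polynomials with arbitrary real frequencies. -/
def trigAlg : Subalgebra ℂ (ℝ → ℂ) := Algebra.adjoin ℂ (Set.range meanExp)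

lemma continuous_meanExp (l : ℝ) : Continuous (meanExp l) := by
  unfold meanExp; fun_prop

lemma trigAlg_eq_span : Subalgebra.toSubmodule trigAlg = Submodule.span ℂ (Set.range meanExp) := by
  unfold trigAlg
  rw [Algebra.adjoin_eq_span]
  let S : Submonoid (ℝ → ℂ) :=
    { carrier := Set.range meanExp
      one_mem' := ⟨0, by ext t; simp [meanExp]⟩
      mul_mem' := by
        rintro _ _ ⟨l, rfl⟩ ⟨m, rfl⟩
        refine ⟨l + m, ?_⟩
        ext t
        simp only [meanExp, Pi.mul_apply, ← Complex.exp_add]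
        congr 1
        push_cast
        ring }
  have : Submonoid.closure (Set.range meanExp) = S := Submonoid.closure_eq S
  rw [this]
  rfl

lemma dirEval_mem_trigAlg (a : ℕ+ →₀ ℂ) :
    (fun t : ℝ => dirEval a ((t : ℂ) * Complex.I)) ∈ trigAlg := by
  have h : (fun t : ℝ => dirEval a ((t : ℂ) * Complex.I))
      = ∑ n ∈ a.support, a n • meanExp (-Real.log (n : ℕ)) := by
    ext t
    simp only [dirEval, Finsupp.sum, Finset.sum_apply, Pi.smul_apply, smul_eq_mul, meanExp]
    refine Finset.sum_congr rfl fun n _ => ?_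
    have hn : (((n : ℕ) : ℂ)) ≠ 0 := by simp
    rw [Complex.cpow_def_of_ne_zero hn, Complex.natCast_log.symm]
    congr 2
    push_cast
    ring
  rw [h]
  exact sum_mem fun n _ => Subalgebra.smul_mem trigAlg
    (Algebra.subset_adjoin (Set.mem_range_self (-Real.log (n : ℕ)))) (a n)

lemma conj_mem_trigAlg {f : ℝ → ℂ} (hf : f ∈ trigAlg) :
    (fun t => (starRingEnd ℂ) (f t)) ∈ trigAlg := by
  unfold trigAlg at hf
  induction hf using Algebra.adjoin_induction with
  | mem x hx =>
    obtain ⟨l, rfl⟩ := hx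
    refine Algebra.subset_adjoin ⟨-l, ?_⟩
    ext t
    simp [meanExp, ← Complex.exp_conj]
  | algebraMap r => exact Subalgebra.algebraMap_mem trigAlg ((starRingEnd ℂ) r)
  | add x y _ _ hx hy =>
    have h := add_mem hx hy
    convert h using 1
    ext t
    simp
  | mul x y _ _ hx hy =>
    have h := mul_mem hx hy
    convert h using 1
    ext t
    simp

lemma tendsto_mean_meanExp (l : ℝ) :
    Tendsto (fun T : ℝ => ((1 / T : ℝ) : ℂ) * ∫ t in (0 : ℝ)..T, meanExp l t) atTop
      (𝓝 (if l = 0 then 1 else 0)) := by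
  by_cases hl : l = 0
  · subst hl
    refine (tendsto_const_nhds (x := (1 : ℂ))).congr' ?_ |>.trans (by simp)
    filter_upwards [eventually_gt_atTop 0] with T hT
    have : (T : ℂ) ≠ 0 := by exact_mod_cast hT.ne'
    simp [meanExp, this]
  · simp only [hl, if_false]
    have hc : ((l : ℂ) * Complex.I) ≠ 0 := by simp [hl]
    have hI : ∀ T : ℝ, ∫ t in (0 : ℝ)..T, meanExp l t
        = (Complex.exp ((l : ℂ) * Complex.I * T) - 1) / ((l : ℂ) * Complex.I) := by
      intro T
      have := integral_exp_mul_complex (a := 0) (b := T) hc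
      simp only [Complex.ofReal_zero, mul_zero, Complex.exp_zero] at this
      rw [← this]
      congr 1
      ext t
      simp only [meanExp]
      congr 1
      ring
    rw [tendsto_zero_iff_norm_tendsto_zero]
    have hlim : Tendsto (fun T : ℝ => (1 / T) * (2 / |l|)) atTop (𝓝 0) := by
      simpa using (tendsto_inv_atTop_zero (𝕜 := ℝ)).mul_const (2 / |l|)
    refine squeeze_zero' (Eventually.of_forall fun _ => norm_nonneg _) ?_ hlim
    filter_upwards [eventually_gt_atTop 0] with T hT
    rw [hI, norm_mul, Complex.norm_real, Real.norm_of_nonneg (by positivity), norm_div]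
    gcongr
    · calc ‖Complex.exp ((l : ℂ) * Complex.I * T) - 1‖
          ≤ ‖Complex.exp ((l : ℂ) * Complex.I * T)‖ + ‖(1 : ℂ)‖ := norm_sub_le _ _
        _ = 2 := by
          have : (l : ℂ) * Complex.I * T = ((l * T : ℝ) : ℂ) * Complex.I := by push_cast; ring
          rw [this, Complex.norm_exp_ofReal_mul_I]
          norm_num
    · simp

lemma trigAlg_mean {f : ℝ → ℂ} (hf : f ∈ trigAlg) :
    (Continuous f ∧ ∃ B, ∀ t, ‖f t‖ ≤ B) ∧
      ∃ c, Tendsto (fun T : ℝ => ((1 / T : ℝ) : ℂ) * ∫ t in (0 : ℝ)..T, f t) atTop (𝓝 c) := by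
  rw [← Subalgebra.mem_toSubmodule, trigAlg_eq_span] at hf
  induction hf using Submodule.span_induction with
  | mem x hx =>
    obtain ⟨l, rfl⟩ := hx
    refine ⟨⟨continuous_meanExp l, 1, fun t => ?_⟩, _, tendsto_mean_meanExp l⟩
    have : (l : ℂ) * t * Complex.I = ((l * t : ℝ) : ℂ) * Complex.I := by push_cast; ring
    rw [meanExp, this, Complex.norm_exp_ofReal_mul_I]
  | zero => exact ⟨⟨continuous_zero, 0, by simp⟩, 0, by simp⟩
  | add x y _ _ hx hy =>
    obtain ⟨⟨hxc, B, hB⟩, c, hc⟩ := hx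
    obtain ⟨⟨hyc, B', hB'⟩, c', hc'⟩ := hy
    refine ⟨⟨hxc.add hyc, B + B', fun t => (norm_add_le _ _).trans (add_le_add (hB t) (hB' t))⟩,
      c + c', ?_⟩
    refine (hc.add hc').congr fun T => ?_
    simp only [Pi.add_apply]
    rw [intervalIntegral.integral_add (hxc.intervalIntegrable _ _) (hyc.intervalIntegrable _ _)]
    ring
  | smul r x _ hx =>
    obtain ⟨⟨hxc, B, hB⟩, c, hc⟩ := hx
    refine ⟨⟨hxc.const_smul r, ‖r‖ * B, fun t => ?_⟩, r * c, ?_⟩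
    · simp only [Pi.smul_apply, smul_eq_mul, norm_mul]
      exact mul_le_mul_of_nonneg_left (hB t) (norm_nonneg _)
    · refine (hc.const_mul r).congr fun T => ?_
      simp only [Pi.smul_apply, smul_eq_mul]
      rw [intervalIntegral.integral_const_mul]
      ring

lemma continuous_dirEval_I (a : ℕ+ →₀ ℂ) :
    Continuous fun t : ℝ => dirEval a ((t : ℂ) * Complex.I) :=
  (trigAlg_mean (dirEval_mem_trigAlg a)).1.1

/-- Means of real functions that are uniform limits of trigonometric polynomials exist. -/
lemma exists_mean_of_approx (g : ℝ → ℝ) (hg : Continuous g)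
    (happ : ∀ ε > 0, ∃ f ∈ trigAlg, ∀ t, ‖(g t : ℂ) - f t‖ ≤ ε) :
    ∃ c : ℝ, Tendsto (fun T : ℝ => (1 / T) * ∫ t in (0 : ℝ)..T, g t) atTop (𝓝 c) := by
  refine CompleteSpace.complete (Metric.cauchy_iff.2 ⟨inferInstance, fun ε hε => ?_⟩)
  obtain ⟨f, hf, hfg⟩ := happ (ε / 6) (by positivity)
  obtain ⟨⟨hfc, -⟩, c, hc⟩ := trigAlg_mean hf
  have hev := (Metric.tendsto_nhds.1 hc) (ε / 6) (by positivity)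
  have hev' : ∀ᶠ T : ℝ in atTop,
      ‖(((1 / T) * ∫ t in (0 : ℝ)..T, g t : ℝ) : ℂ) - c‖ < ε / 2 := by
    filter_upwards [hev, eventually_gt_atTop 0] with T hT hT0
    have h1 : (((1 / T) * ∫ t in (0 : ℝ)..T, g t : ℝ) : ℂ)
        - ((1 / T : ℝ) : ℂ) * ∫ t in (0 : ℝ)..T, f t
        = ((1 / T : ℝ) : ℂ) * ∫ t in (0 : ℝ)..T, ((g t : ℂ) - f t) := by
      have hgc : Continuous fun t => (g t : ℂ) := Complex.continuous_ofReal.comp hg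
      rw [intervalIntegral.integral_sub (hgc.intervalIntegrable _ _)
        (hfc.intervalIntegrable _ _), intervalIntegral.integral_ofReal]
      push_cast
      ring
    have h2 : ‖∫ t in (0 : ℝ)..T, ((g t : ℂ) - f t)‖ ≤ ε / 6 * |T - 0| :=
      intervalIntegral.norm_integral_le_of_norm_le_const fun t _ => hfg t
    have h3 : ‖(((1 / T) * ∫ t in (0 : ℝ)..T, g t : ℝ) : ℂ)
        - ((1 / T : ℝ) : ℂ) * ∫ t in (0 : ℝ)..T, f t‖ ≤ ε / 6 := by
      rw [h1, norm_mul, Complex.norm_real, Real.norm_of_nonneg (by positivity)]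
      rw [sub_zero, abs_of_pos hT0] at h2
      calc 1 / T * _ ≤ 1 / T * (ε / 6 * T) := by gcongr
        _ = ε / 6 := by field_simp
    rw [dist_eq_norm] at hT
    calc _ = ‖((((1 / T) * ∫ t in (0 : ℝ)..T, g t : ℝ) : ℂ)
        - ((1 / T : ℝ) : ℂ) * ∫ t in (0 : ℝ)..T, f t)
        + (((1 / T : ℝ) : ℂ) * (∫ t in (0 : ℝ)..T, f t) - c)‖ := by congr 1; ring
      _ ≤ _ := norm_add_le _ _
      _ < ε / 2 := by linarith
  refine ⟨{x : ℝ | ‖(x : ℂ) - c‖ < ε / 2}, hev', fun x hx y hy => ?_⟩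
  simp only [Set.mem_ofPred_eq] at hx hy
  rw [Real.dist_eq, ← Real.norm_eq_abs, ← Complex.norm_real, Complex.ofReal_sub]
  calc ‖(x : ℂ) - y‖ = ‖((x : ℂ) - c) - ((y : ℂ) - c)‖ := by congr 1; ring
    _ ≤ ‖(x : ℂ) - c‖ + ‖(y : ℂ) - c‖ := norm_sub_le _ _
    _ < ε := by linarith

lemma exists_tendsto_dirMean (p : ℝ) (hp : 0 ≤ p) (a : ℕ+ →₀ ℂ) :
    ∃ c : ℝ, Tendsto (dirMean p a) atTop (𝓝 c) := by
  set F : ℝ → ℂ := fun t => dirEval a ((t : ℂ) * Complex.I) with hF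
  have hFm : F ∈ trigAlg := dirEval_mem_trigAlg a
  obtain ⟨⟨hFc, B, hB⟩, -⟩ := trigAlg_mean hFm
  refine exists_mean_of_approx (fun t => ‖F t‖ ^ p) (hFc.norm.rpow_const fun _ => Or.inr hp) ?_
  intro ε hε
  obtain ⟨q, hq⟩ := exists_polynomial_near_of_continuousOn 0 (B ^ 2) (fun x => x ^ (p / 2))
    (Real.continuous_rpow_const (by positivity)).continuousOn ε hε
  let G : ℝ → ℂ := F * fun t => (starRingEnd ℂ) (F t)
  have hG : G ∈ trigAlg := mul_mem hFm (conj_mem_trigAlg hFm)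
  refine ⟨Polynomial.aeval G (q.map (algebraMap ℝ ℂ)), ?_, fun t => ?_⟩
  · rw [Polynomial.aeval_eq_sum_range]
    exact sum_mem fun i _ => Subalgebra.smul_mem trigAlg (pow_mem hG i) _
  have h1 : (Polynomial.aeval G (q.map (algebraMap ℝ ℂ))) t = ((q.eval (‖F t‖ ^ 2) : ℝ) : ℂ) := by
    have hGt : G t = ((‖F t‖ ^ 2 : ℝ) : ℂ) := by
      simp [G, Complex.mul_conj, Complex.normSq_eq_norm_sq]
    have := Polynomial.aeval_algHom_apply (Pi.evalAlgHom ℂ (fun _ : ℝ => ℂ) t) G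
      (q.map (algebraMap ℝ ℂ))
    simp only [Pi.evalAlgHom_apply] at this
    rw [← this, hGt, Polynomial.aeval_map_algebraMap]
    exact Polynomial.aeval_algebraMap_apply ℂ (‖F t‖ ^ 2) q
  have h2 := hq (‖F t‖ ^ 2) ⟨by positivity, pow_le_pow_left₀ (norm_nonneg _) (hB t) 2⟩
  have h3 : (‖F t‖ ^ 2) ^ (p / 2) = ‖F t‖ ^ p := by
    rw [← Real.rpow_natCast, ← Real.rpow_mul (norm_nonneg _)]
    congr 1
    push_cast
    ring
  rw [h1, ← Complex.ofReal_sub, Complex.norm_real, Real.norm_eq_abs, abs_sub_comm]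
  rw [h3] at h2
  exact h2.le

lemma tendsto_dirMean (p : ℝ) (hp : 0 ≤ p) (a : ℕ+ →₀ ℂ) :
    Tendsto (dirMean p a) atTop (𝓝 (limUnder atTop (dirMean p a))) :=
  tendsto_nhds_limUnder (exists_tendsto_dirMean p hp a)

lemma dirMean_nonneg (p : ℝ) (a : ℕ+ →₀ ℂ) {T : ℝ} (hT : 0 < T) : 0 ≤ dirMean p a T :=
  mul_nonneg (by positivity)
    (intervalIntegral.integral_nonneg hT.le fun _ _ => by positivity)

lemma tendsto_dirMean_rpow (p : ℝ) (hp : 0 ≤ p) (a : ℕ+ →₀ ℂ) :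
    Tendsto (fun T => dirMean p a T ^ (1 / p)) atTop (𝓝 (dirNorm p a)) :=
  (tendsto_dirMean p hp a).rpow_const (Or.inr (by positivity))

/-- Normalized Lebesgue measure on `(0, T]`. -/
def meanMeasure (T : ℝ) : Measure ℝ := ENNReal.ofReal (1 / T) • volume.restrict (Set.Ioc 0 T)

lemma isProb_meanMeasure {T : ℝ} (hT : 0 < T) : IsProbabilityMeasure (meanMeasure T) := by
  refine ⟨?_⟩
  simp only [meanMeasure, Measure.smul_apply, Measure.restrict_apply MeasurableSet.univ,
    Set.univ_inter, Real.volume_Ioc, smul_eq_mul, sub_zero]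
  rw [← ENNReal.ofReal_mul (by positivity), one_div, inv_mul_cancel₀ hT.ne', ENNReal.ofReal_one]

lemma eLpNorm_meanMeasure (p : ℝ) (hp : 1 ≤ p) (a : ℕ+ →₀ ℂ) {T : ℝ} (hT : 0 < T) :
    MemLp (fun t : ℝ => dirEval a ((t : ℂ) * Complex.I)) (ENNReal.ofReal p) (meanMeasure T) ∧
    eLpNorm (fun t : ℝ => dirEval a ((t : ℂ) * Complex.I)) (ENNReal.ofReal p) (meanMeasure T)
      = ENNReal.ofReal (dirMean p a T ^ (1 / p)) := by
  have := isProb_meanMeasure hT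
  obtain ⟨⟨hc, B, hB⟩, -⟩ := trigAlg_mean (dirEval_mem_trigAlg a)
  have hm : MemLp (fun t : ℝ => dirEval a ((t : ℂ) * Complex.I)) (ENNReal.ofReal p)
      (meanMeasure T) :=
    MemLp.of_bound hc.aestronglyMeasurable B (Eventually.of_forall hB)
  refine ⟨hm, ?_⟩
  rw [hm.eLpNorm_eq_integral_rpow_norm (by simp; linarith) (by simp)]
  rw [ENNReal.toReal_ofReal (by linarith), one_div, meanMeasure, integral_smul_measure,
    ENNReal.toReal_ofReal (by positivity), dirMean, intervalIntegral.integral_of_le hT.le,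
    smul_eq_mul]

lemma dirNorm_nonneg (p : ℝ) (hp : 0 ≤ p) (a : ℕ+ →₀ ℂ) : 0 ≤ dirNorm p a :=
  ge_of_tendsto (tendsto_dirMean_rpow p hp a) <| by
    filter_upwards [eventually_gt_atTop 0] with T hT
    exact Real.rpow_nonneg (dirMean_nonneg p a hT) _

lemma dirNorm_add_le (p : ℝ) (hp : 1 ≤ p) (a b : ℕ+ →₀ ℂ) :
    dirNorm p (a + b) ≤ dirNorm p a + dirNorm p b := by
  have hp0 : 0 ≤ p := by linarith
  refine le_of_tendsto_of_tendsto (tendsto_dirMean_rpow p hp0 _)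
    ((tendsto_dirMean_rpow p hp0 a).add (tendsto_dirMean_rpow p hp0 b)) ?_
  filter_upwards [eventually_gt_atTop 0] with T hT
  have ha := eLpNorm_meanMeasure p hp a hT
  have hb := eLpNorm_meanMeasure p hp b hT
  have hab := (eLpNorm_meanMeasure p hp (a + b) hT).2
  have key := eLpNorm_add_le ha.1.1 hb.1.1 (ENNReal.one_le_ofReal.2 hp)
  have heq : (fun t : ℝ => dirEval (a + b) ((t : ℂ) * Complex.I))
      = (fun t : ℝ => dirEval a ((t : ℂ) * Complex.I))
        + fun t : ℝ => dirEval b ((t : ℂ) * Complex.I) := by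
    ext t; exact dirEval_add a b _
  rw [heq] at hab
  rw [hab, ha.2, hb.2, ← ENNReal.ofReal_add (Real.rpow_nonneg (dirMean_nonneg p a hT) _)
    (Real.rpow_nonneg (dirMean_nonneg p b hT) _)] at key
  exact (ENNReal.ofReal_le_ofReal_iff (add_nonneg (Real.rpow_nonneg (dirMean_nonneg p a hT) _)
    (Real.rpow_nonneg (dirMean_nonneg p b hT) _))).1 key

lemma dirNorm_smul (p : ℝ) (hp : 1 ≤ p) (c : ℂ) (a : ℕ+ →₀ ℂ) :
    dirNorm p (c • a) = ‖c‖ * dirNorm p a := by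
  have hp0 : 0 < p := by linarith
  refine tendsto_nhds_unique (tendsto_dirMean_rpow p hp0.le _)
    (((tendsto_dirMean_rpow p hp0.le a).const_mul ‖c‖).congr' ?_)
  filter_upwards [eventually_gt_atTop 0] with T hT
  have : dirMean p (c • a) T = ‖c‖ ^ p * dirMean p a T := by
    unfold dirMean
    simp_rw [dirEval_smul, norm_mul, Real.mul_rpow (norm_nonneg _) (norm_nonneg _)]
    rw [intervalIntegral.integral_const_mul]
    ring
  rw [this, Real.mul_rpow (by positivity) (dirMean_nonneg p a hT), ← Real.rpow_mul (norm_nonneg _),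
    mul_one_div_cancel hp0.ne', Real.rpow_one]

lemma tendsto_coeff_mean (a : ℕ+ →₀ ℂ) (n : ℕ+) :
    Tendsto (fun T : ℝ => ((1 / T : ℝ) : ℂ) *
      ∫ t in (0 : ℝ)..T, dirEval a ((t : ℂ) * Complex.I) * meanExp (Real.log (n : ℕ)) t)
      atTop (𝓝 (a n)) := by
  have h : ∀ T : ℝ, ((1 / T : ℝ) : ℂ) *
      ∫ t in (0 : ℝ)..T, dirEval a ((t : ℂ) * Complex.I) * meanExp (Real.log (n : ℕ)) t
      = ∑ m ∈ a.support, a m * (((1 / T : ℝ) : ℂ) *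
        ∫ t in (0 : ℝ)..T, meanExp (Real.log (n : ℕ) - Real.log (m : ℕ)) t) := by
    intro T
    have h1 : (fun t : ℝ => dirEval a ((t : ℂ) * Complex.I) * meanExp (Real.log (n : ℕ)) t)
        = fun t : ℝ => ∑ m ∈ a.support,
          a m * meanExp (Real.log (n : ℕ) - Real.log (m : ℕ)) t := by
      ext t
      simp only [dirEval, Finsupp.sum, meanExp, Finset.sum_mul]
      refine Finset.sum_congr rfl fun m _ => ?_
      have hm : (((m : ℕ) : ℂ)) ≠ 0 := by simp
      rw [Complex.cpow_def_of_ne_zero hm, Complex.natCast_log.symm, mul_assoc, ← Complex.exp_add]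
      congr 2
      push_cast
      ring
    have hi : ∀ m ∈ a.support, IntervalIntegrable
        (fun t => a m * meanExp (Real.log (n : ℕ) - Real.log (m : ℕ)) t) volume 0 T :=
      fun m _ => (continuous_const.mul (continuous_meanExp _)).intervalIntegrable _ _
    rw [h1, intervalIntegral.integral_finsetSum hi, Finset.mul_sum]
    refine Finset.sum_congr rfl fun m _ => ?_
    rw [intervalIntegral.integral_const_mul]
    ring
  simp_rw [h]
  have h2 := tendsto_finsetSum a.support fun m _ =>
    (tendsto_mean_meanExp (Real.log (n : ℕ) - Real.log (m : ℕ))).const_mul (a m)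
  convert h2 using 2
  have h3 : ∀ m : ℕ+, (Real.log (n : ℕ) - Real.log (m : ℕ) = 0) ↔ n = m := by
    intro m
    rw [sub_eq_zero]
    constructor
    · intro h
      have := Real.log_injOn_pos (by simp) (by simp) h
      exact_mod_cast this
    · rintro rfl; rfl
  simp [h3]

lemma norm_coeff_le (p : ℝ) (hp : 1 ≤ p) (a : ℕ+ →₀ ℂ) (n : ℕ+) : ‖a n‖ ≤ dirNorm p a := by
  have hp0 : 0 ≤ p := by linarith
  refine le_of_tendsto_of_tendsto (tendsto_coeff_mean a n).norm (tendsto_dirMean_rpow p hp0 a) ?_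
  filter_upwards [eventually_gt_atTop 0] with T hT
  have := isProb_meanMeasure hT
  have hpp := eLpNorm_meanMeasure p hp a hT
  have h1 := eLpNorm_meanMeasure 1 le_rfl a hT
  have hle : eLpNorm (fun t : ℝ => dirEval a ((t : ℂ) * Complex.I)) (ENNReal.ofReal 1)
      (meanMeasure T) ≤ eLpNorm (fun t : ℝ => dirEval a ((t : ℂ) * Complex.I)) (ENNReal.ofReal p)
      (meanMeasure T) :=
    eLpNorm_le_eLpNorm_of_exponent_le (ENNReal.ofReal_le_ofReal hp) hpp.1.1
  rw [h1.2, hpp.2, ENNReal.ofReal_le_ofReal_iff (Real.rpow_nonneg (dirMean_nonneg p a hT) _)] at hle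
  refine le_trans ?_ hle
  rw [norm_mul, Complex.norm_real, Real.norm_of_nonneg (by positivity)]
  simp only [dirMean, Real.rpow_one, div_one]
  gcongr
  refine (intervalIntegral.norm_integral_le_integral_norm hT.le).trans (le_of_eq ?_)
  congr 1
  ext t
  have : ((Real.log (n : ℕ) : ℝ) : ℂ) * t * Complex.I
      = ((Real.log (n : ℕ) * t : ℝ) : ℂ) * Complex.I := by push_cast; ring
  rw [norm_mul, meanExp, this, Complex.norm_exp_ofReal_mul_I, mul_one]

/-! ### The spaces `H^p` and `H^p_0` -/

/-- The vector space of Dirichlet polynomials, to be normed by `dirNorm p`. -/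
def DirPoly (_p : ℝ) : Type := ℕ+ →₀ ℂ

namespace DirPoly

variable (p : ℝ)

instance : AddCommGroup (DirPoly p) := inferInstanceAs (AddCommGroup (ℕ+ →₀ ℂ))

instance : Module ℂ (DirPoly p) := inferInstanceAs (Module ℂ (ℕ+ →₀ ℂ))

instance : Norm (DirPoly p) := ⟨fun P => dirNorm p P⟩

/-- The finitely supported coefficient sequence of a Dirichlet polynomial. -/
def coeffs : DirPoly p ≃ₗ[ℂ] (ℕ+ →₀ ℂ) := LinearEquiv.refl ℂ (ℕ+ →₀ ℂ)

variable {p} in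
/-- The value `P(s)` of a Dirichlet polynomial. -/
def eval (P : DirPoly p) (s : ℂ) : ℂ := dirEval (coeffs p P) s

lemma normedCore [hp : Fact (1 ≤ p)] : NormedSpace.Core ℂ (DirPoly p) where
  norm_nonneg P := dirNorm_nonneg p (by linarith [hp.out]) P
  norm_smul c P := dirNorm_smul p hp.out c P
  norm_triangle P Q := dirNorm_add_le p hp.out P Q
  norm_eq_zero_iff P := by
    constructor
    · intro h
      refine Finsupp.ext fun n => ?_
      have := norm_coeff_le p hp.out P n
      exact norm_le_zero_iff.1 (this.trans h.le)
    · rintro rfl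
      have h : dirNorm p 0 = 0 := by simpa using dirNorm_smul p hp.out 0 0
      exact h

instance [Fact (1 ≤ p)] : NormedAddCommGroup (DirPoly p) :=
  NormedAddCommGroup.ofCore (normedCore p)

instance [Fact (1 ≤ p)] : NormedSpace ℂ (DirPoly p) := NormedSpace.ofCore (normedCore p)

/-- The `n`-th coefficient, a linear functional of norm at most one on Dirichlet polynomials. -/
def coeffCLM [hp : Fact (1 ≤ p)] (n : ℕ+) : DirPoly p →L[ℂ] ℂ :=
  LinearMap.mkContinuous (Finsupp.lapply n ∘ₗ (coeffs p).toLinearMap) 1 fun P => by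
    rw [one_mul]
    exact norm_coeff_le p hp.out P n

end DirPoly

/-- `H^p`: the completion of the Dirichlet polynomials in the norm
`(lim_{T → ∞} (1/T) ∫_0^T |P(it)|^p dt)^{1/p}`. -/
abbrev DirHardy (p : ℝ) [Fact (1 ≤ p)] : Type := UniformSpace.Completion (DirPoly p)

namespace DirHardy

variable {p : ℝ} [Fact (1 ≤ p)]

/-- The `n`-th Dirichlet coefficient of an element of `H^p`: the continuous extension of the
`n`-th coefficient of Dirichlet polynomials. -/
def coeff (n : ℕ+) : DirHardy p →L[ℂ] ℂ :=
  (DirPoly.coeffCLM p n).extend UniformSpace.Completion.toComplL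

lemma coeff_coe (n : ℕ+) (P : DirPoly p) :
    coeff n (P : DirHardy p) = DirPoly.coeffs p P n :=
  ContinuousLinearMap.extend_eq (DirPoly.coeffCLM p n)
    (e := (UniformSpace.Completion.toComplL : DirPoly p →L[ℂ] DirHardy p))
    UniformSpace.Completion.denseRange_coe (UniformSpace.Completion.isUniformInducing_coe _) P

/-- The function `f(s) = ∑ aₙ n^{-s}`, `Re s > 1/2`, given by the Dirichlet series of `f ∈ H^p`. -/
def toFun (f : DirHardy p) (s : ℂ) : ℂ := ∑' n : ℕ+, coeff n f * ((n : ℕ) : ℂ) ^ (-s)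

lemma toFun_coe (P : DirPoly p) (s : ℂ) : toFun (P : DirHardy p) s = P.eval s := by
  simp only [toFun, coeff_coe, DirPoly.eval, dirEval, Finsupp.sum]
  exact tsum_eq_sum fun n hn => by simp [Finsupp.notMem_support_iff.1 hn]

end DirHardy

/-- `H^p_0`: the subspace of `H^p` of Dirichlet series `∑_{n ≥ 2} aₙ n^{-s}`, which vanish
at `+∞`. -/
def DirHardyZero (p : ℝ) [Fact (1 ≤ p)] : Submodule ℂ (DirHardy p) :=
  LinearMap.ker (DirHardy.coeff (p := p) 1).toLinearMap

/-- The integral operator `Hf(s) = ∫_{1/2}^∞ f(w) (ζ(w + s) - 1) dw`. -/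
def mulHilbert (f : ℂ → ℂ) (s : ℂ) : ℂ :=
  ∫ w in Set.Ioi (1 / 2 : ℝ), f (w : ℂ) * (riemannZeta ((w : ℂ) + s) - 1)

end

/-! ### Elementary inequalities and sums over primes -/

noncomputable section

/-! Put `x_q = q^(-1/2)` and `S = ∑ x_q²` over the primes `y ≤ q < N`. The operator is tested on `P
= ∏ (1 + (2/p) x_q q^(-s)) - 1` and the result is paired with a trigonometric product `G` in the
`q^(it)`. Because logarithms of distinct primes are rationally independent, mean values of such
products factor over the primes, so every estimate reduces to a second order expansion of one factor
on the unit circle.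

If `F` is the transform of `P`, its coefficients for `n ≥ 2` are `∫ P(w) n^(-w) dw` over `w > 1/2`
(`DirHardy.coeff_eq_hilbertCoeff`). `P` is nonnegative and decreasing on the real axis, so keeping
only `1/2 < w ≤ 1/2 + δ` gives at least `δ P(1/2+δ) n^(-1/2-δ)`. `F` has only the frequencies `-log
n`, so the pairing sees only the part `g(s) = ∑ g_n n^(-s)` of `G` with nonnegative exponents. When
`g_n ≥ 0`, Hölder's inequality gives `δ P(1/2+δ) (g(1/2+δ) - g_1) ≤ ‖G‖_{p'} ‖T‖ ‖P‖_p`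
(`hilbert_operator_inequality`).

The factor of `G` is close to `e^{i x sin θ} (1 + (p-1) x cos θ)`. The first factor is almost
unimodular, hence costs nothing in norm, yet raises the coefficient of `e^{iθ}` to about `p x / 2`.
Up to `ε` in the exponents, `‖P‖ ≲ e^{S/p}`, `‖G‖ ≲ e^{(p-1)S/4}`, `P(1/2+δ) ≳ e^{2S/p}` and
`g(1/2+δ) ≳ e^{(p/2-1/4)S}`, the last two for `δ = η / log N`. Together they yield `δ e^{(1/p + p/4)
S} ≲ ‖T‖` (`mul_exp_le_of_euler_factor_bounds`).

Euler's product gives `log N ≤ C e^S`, so `δ` is at least a constant times `e^{-S}`. Since `1/p +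
p/4 - 1 = (p-2)²/(4p)` is positive exactly when `p ≠ 2`, letting `S → ∞` is a contradiction. -/

lemma exists_one_add_rpow_le (r : ℝ) {ε : ℝ} (hε : 0 < ε) :
    ∃ η > 0, ∀ v : ℝ, |v| ≤ η →
      (1 + v) ^ r ≤ 1 + r * v + (r * (r - 1) / 2 + ε) * v ^ 2 := by
  have hd : HasDerivAt (fun v : ℝ => r * (1 + v) ^ (r - 1)) (r * (r - 1)) 0 := by
    have h1 : HasDerivAt (fun v : ℝ => 1 + v) 1 0 := (hasDerivAt_id _).const_add 1
    have h2 := (h1.rpow_const (p := r - 1) (Or.inl (by norm_num))).const_mul r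
    simpa using h2
  have ho := hd.isLittleO.def hε
  obtain ⟨η, hη, hball⟩ := Metric.eventually_nhds_iff.1 ho
  refine ⟨min (η / 2) (1 / 2), by positivity, fun v hv => ?_⟩
  have hv1 : |v| ≤ η / 2 := hv.trans (min_le_left _ _)
  have hv2 : |v| ≤ 1 / 2 := hv.trans (min_le_right _ _)
  -- The mean value inequality for the Taylor remainder: its derivative is at most `ε |u| ≤ ε |v|`
  -- on the ball, by differentiability of `r (1 + u)^(r-1)` at `0`.
  have key := (convex_closedBall (0 : ℝ) |v|).norm_image_sub_le_of_norm_hasDerivWithin_le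
    (f := fun u : ℝ => (1 + u) ^ r - (1 + r * u + r * (r - 1) / 2 * u ^ 2))
    (f' := fun u : ℝ => r * (1 + u) ^ (r - 1) - (r + r * (r - 1) * u)) (C := ε * |v|)
    (x := 0) (y := v) ?_ ?_ (by simp) (by simp)
  · simp only [add_zero, Real.one_rpow, mul_zero, ne_eq, OfNat.ofNat_ne_zero, not_false_eq_true,
      zero_pow, sub_self, sub_zero, Real.norm_eq_abs] at key
    have h2 := (abs_le.1 key).2
    have h3 : ε * |v| * |v| = ε * v ^ 2 := by rw [mul_assoc, abs_mul_abs_self]; ring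
    linarith
  · intro u hu
    have hu' : |u| ≤ |v| := by simpa using hu
    have h1 : HasDerivAt (fun v : ℝ => 1 + v) 1 u := (hasDerivAt_id _).const_add 1
    have hne : (1 + u) ≠ 0 := by
      have := (abs_le.1 (hu'.trans hv2)).1
      linarith
    have h2 := h1.rpow_const (p := r) (Or.inl hne)
    have h3 : HasDerivAt (fun u : ℝ => 1 + r * u + r * (r - 1) / 2 * u ^ 2)
        (r + r * (r - 1) * u) u := by
      have h4 := ((hasDerivAt_id u).const_mul r).const_add 1
      have h5 := ((hasDerivAt_id u).pow 2).const_mul (r * (r - 1) / 2)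
      refine (h4.add h5).congr_deriv ?_
      simp; ring
    refine ((h2.sub h3).congr_deriv ?_).hasDerivWithinAt
    ring
  · intro u hu
    have hu' : |u| ≤ |v| := by simpa using hu
    have := hball (y := u) (by simp only [dist_zero_right, Real.norm_eq_abs]; linarith)
    simp only [add_zero, Real.one_rpow, mul_one, sub_zero, smul_eq_mul, Real.norm_eq_abs] at this
    rw [Real.norm_eq_abs]
    calc _ = |r * (1 + u) ^ (r - 1) - r - u * (r * (r - 1))| := by congr 1; ring
      _ ≤ ε * |u| := this
      _ ≤ _ := by gcongr

lemma exists_exp_mul_le_one_add {c d : ℝ} (hdc : d < c) :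
    ∃ η > 0, ∀ x : ℝ, 0 ≤ x → x ≤ η → Real.exp (d * x) ≤ 1 + c * x := by
  have hd : HasDerivAt (fun x : ℝ => Real.exp (d * x)) d 0 := by
    simpa using ((hasDerivAt_id (0 : ℝ)).const_mul d).exp
  obtain ⟨η, hη, hball⟩ := Metric.eventually_nhds_iff.1 (hd.isLittleO.def (sub_pos.2 hdc))
  refine ⟨η / 2, by positivity, fun x hx hxη => ?_⟩
  have := hball (y := x) (by rw [dist_zero_right, Real.norm_of_nonneg hx]; linarith)
  simp only [mul_zero, Real.exp_zero, sub_zero, smul_eq_mul, Real.norm_eq_abs, abs_of_nonneg hx]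
    at this
  linarith [(abs_le.1 this).2]

/-! ### Euler's lower bound for the sum of reciprocals of primes -/

/-- The multiplicative function `n ↦ 1 / n`. -/
def invHom : ℕ →* ℝ where
  toFun n := (n : ℝ)⁻¹
  map_one' := by simp
  map_mul' m n := by push_cast; rw [mul_inv]

/-- The product expands into the sum of `1/m` over all `N`-smooth `m`, which include every `m < N`;
the harmonic sum up to `N - 1` is at least `log N`. -/
lemma log_le_prod_primesBelow (N : ℕ) (hN : 0 < N) :
    Real.log N ≤ ∏ q ∈ N.primesBelow, (1 - (q : ℝ)⁻¹)⁻¹ := by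
  have h := EulerProduct.summable_and_hasSum_smoothNumbers_prod_primesBelow_geometric
    (f := invHom) (fun {q} hq => by
      have : (1 : ℝ) < q := by exact_mod_cast hq.one_lt
      simpa [invHom] using inv_lt_one_of_one_lt₀ this) N
  -- Only `n < N - 1` is used; the value `1` elsewhere merely makes the map total.
  let e : ℕ → N.smoothNumbers := fun n =>
    if h : n + 1 < N then ⟨n + 1, Nat.mem_smoothNumbers_of_lt (by omega) h⟩
    else ⟨1, one_ne_zero, by simp⟩
  have he : ∀ n ∈ Finset.range (N - 1), ((e n : ℕ) = n + 1) := fun n hn => by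
    have : n + 1 < N := by have := Finset.mem_range.1 hn; omega
    simp [e, this]
  have hle := sum_le_hasSum ((Finset.range (N - 1)).image e) (fun m _ => by
    simp [invHom]) h.2
  rw [Finset.sum_image] at hle
  · refine le_trans ?_ hle
    have h2 := log_add_one_le_harmonic (N - 1)
    have h3 : ((N - 1 + 1 : ℕ) : ℝ) = N := by congr 1; omega
    rw [h3] at h2
    refine h2.trans (le_of_eq ?_)
    rw [harmonic]
    push_cast
    refine Finset.sum_congr rfl fun n hn => ?_
    change _ = ((e n : ℕ) : ℝ)⁻¹
    rw [he n hn]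
    push_cast
    rfl
  · intro a ha b hb hab
    have : (e a : ℕ) = e b := by rw [hab]
    rw [he a ha, he b hb] at this
    omega

lemma sum_inv_mul_pred_le (s : Finset ℕ) (hs : ∀ n ∈ s, 2 ≤ n) :
    ∑ n ∈ s, (1 / ((n : ℝ) - 1) - 1 / n) ≤ 1 := by
  obtain ⟨M, hM⟩ := s.bddAbove
  calc ∑ n ∈ s, (1 / ((n : ℝ) - 1) - 1 / n)
      ≤ ∑ n ∈ Finset.Ico 2 (M + 2), (1 / ((n : ℝ) - 1) - 1 / n) := by
        refine Finset.sum_le_sum_of_subset_of_nonneg (fun n hn => ?_) fun n hn _ => ?_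
        · have := hM hn
          have := hs n hn
          simp; omega
        · have h2 : (2 : ℝ) ≤ n := by exact_mod_cast (Finset.mem_Ico.1 hn).1
          rw [sub_nonneg]
          exact one_div_le_one_div_of_le (by linarith) (by linarith)
    _ = ∑ n ∈ Finset.range M, (1 / ((n : ℝ) + 1) - 1 / ((n + 1 : ℕ) + 1)) := by
        rw [Finset.sum_Ico_eq_sum_range]
        refine Finset.sum_congr (by simp) fun n _ => ?_
        push_cast
        congr 2 <;> ring
    _ = 1 - 1 / ((M : ℝ) + 1) := by
        rw [Finset.sum_range_sub' (fun n : ℕ => 1 / ((n : ℝ) + 1))]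
        simp
    _ ≤ 1 := by
        have : 0 ≤ 1 / ((M : ℝ) + 1) := by positivity
        linarith

/-- Each Euler factor is `1 + 1/(q-1) ≤ e^{1/(q-1)}`, and replacing `1/(q-1)` by `1/q` costs a
telescoping sum of total at most `1`. -/
lemma log_le_exp_sum_primesBelow (N : ℕ) (hN : 0 < N) :
    Real.log N ≤ Real.exp (1 + ∑ q ∈ N.primesBelow, 1 / (q : ℝ)) := by
  refine (log_le_prod_primesBelow N hN).trans ?_
  have h2 : ∀ q ∈ N.primesBelow, (2 : ℝ) ≤ q := fun q hq => by
    exact_mod_cast (Nat.prime_of_mem_primesBelow hq).two_le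
  calc ∏ q ∈ N.primesBelow, (1 - (q : ℝ)⁻¹)⁻¹
      ≤ ∏ q ∈ N.primesBelow, Real.exp (1 / ((q : ℝ) - 1)) := by
        refine Finset.prod_le_prod (fun q hq => ?_) fun q hq => ?_
        · have := h2 q hq
          have : (q : ℝ)⁻¹ ≤ 1 := inv_le_one_of_one_le₀ (by linarith)
          exact inv_nonneg.2 (by linarith)
        · have := h2 q hq
          have h3 : (1 - (q : ℝ)⁻¹)⁻¹ = 1 / ((q : ℝ) - 1) + 1 := by
            have : (q : ℝ) - 1 ≠ 0 := by linarith
            have : (q : ℝ) ≠ 0 := by linarith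
            field_simp
            ring
          rw [h3]
          exact Real.add_one_le_exp _
    _ = Real.exp (∑ q ∈ N.primesBelow, 1 / ((q : ℝ) - 1)) := (Real.exp_sum _ _).symm
    _ ≤ _ := by
        refine Real.exp_le_exp.2 ?_
        have := sum_inv_mul_pred_le N.primesBelow fun q hq =>
          (Nat.prime_of_mem_primesBelow hq).two_le
        rw [Finset.sum_sub_distrib] at this
        linarith

/-- The primes `q` with `y ≤ q < N`. -/
def primesBetween (y N : ℕ) : Finset ℕ := N.primesBelow.filter (y ≤ ·)

lemma exists_log_le_exp_sum_primesBetween (y : ℕ) :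
    ∃ C > 0, ∀ N : ℕ, 0 < N →
      Real.log N ≤ C * Real.exp (∑ q ∈ primesBetween y N, 1 / (q : ℝ)) := by
  -- The constant absorbs all primes below `y`; summing over every integer below `y` is a harmless
  -- overcount, with `1 / 0 = 0`.
  refine ⟨Real.exp (1 + ∑ q ∈ Finset.range y, 1 / (q : ℝ)), Real.exp_pos _, fun N hN => ?_⟩
  refine (log_le_exp_sum_primesBelow N hN).trans ?_
  rw [← Real.exp_add, Real.exp_le_exp, add_assoc]
  gcongr
  rw [← Finset.sum_filter_add_sum_filter_not N.primesBelow (y ≤ ·), add_comm]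
  gcongr
  · intro q hq
    have := (Finset.mem_filter.1 hq).2
    simpa using this
  · exact le_rfl

end

/-! ### Mean values of products of trigonometric polynomials -/

noncomputable section

/-- `f` has mean value `c` over `[0, ∞)`. -/
def HasMean (f : ℝ → ℂ) (c : ℂ) : Prop :=
  Tendsto (fun T : ℝ => ((1 / T : ℝ) : ℂ) * ∫ t in (0 : ℝ)..T, f t) atTop (𝓝 c)

lemma hasMean_finsetSum {κ : Type*} (s : Finset κ) {f : κ → ℝ → ℂ} {c : κ → ℂ}
    (hc : ∀ k ∈ s, Continuous (f k)) (h : ∀ k ∈ s, HasMean (f k) (c k)) :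
    HasMean (fun t => ∑ k ∈ s, f k t) (∑ k ∈ s, c k) := by
  refine (tendsto_finsetSum s h).congr fun T => ?_
  rw [intervalIntegral.integral_finsetSum fun k hk => (hc k hk).intervalIntegrable _ _,
    Finset.mul_sum]

lemma HasMean.const_mul {f : ℝ → ℂ} {c : ℂ} (h : HasMean f c) (a : ℂ) :
    HasMean (fun t => a * f t) (a * c) := by
  refine (Tendsto.const_mul a h).congr fun T => ?_
  rw [intervalIntegral.integral_const_mul]
  ring

lemma HasMean.tendsto_real {f : ℝ → ℝ} {c : ℝ} (h : HasMean (fun t => (f t : ℂ)) c) :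
    Tendsto (fun T : ℝ => 1 / T * ∫ t in (0 : ℝ)..T, f t) atTop (𝓝 c) := by
  have := (Complex.continuous_re.tendsto _).comp h
  refine this.congr fun T => ?_
  simp only [Function.comp]
  rw [intervalIntegral.integral_ofReal, ← Complex.ofReal_mul, Complex.ofReal_re]

lemma meanExp_add (l m t : ℝ) : meanExp (l + m) t = meanExp l t * meanExp m t := by
  simp only [meanExp, ← Complex.exp_add]
  congr 1
  push_cast
  ring

lemma meanExp_zero (t : ℝ) : meanExp 0 t = 1 := by simp [meanExp]

lemma meanExp_int_mul (k : ℤ) (l t : ℝ) : meanExp (k * l) t = meanExp l t ^ k := by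
  rw [meanExp, meanExp, ← Complex.exp_int_mul]
  congr 1
  push_cast
  ring

lemma meanExp_sum {ι : Type*} (s : Finset ι) (l : ι → ℝ) (t : ℝ) :
    meanExp (∑ i ∈ s, l i) t = ∏ i ∈ s, meanExp (l i) t := by
  classical
  induction s using Finset.induction_on with
  | empty => simp [meanExp_zero]
  | insert i s hi ih => rw [Finset.sum_insert hi, Finset.prod_insert hi, meanExp_add, ih]

lemma nat_eq_of_log_eq {m n : ℕ} (hm : 0 < m) (hn : 0 < n) (h : Real.log m = Real.log n) :
    m = n := by
  have := Real.log_injOn_pos (Set.mem_Ioi.2 (Nat.cast_pos.2 hm)) (Set.mem_Ioi.2 (Nat.cast_pos.2 hn))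
    h
  exact_mod_cast this

variable {ι : Type*} [Fintype ι]

/-! ### Unique factorization and the frequencies of trigonometric products -/

lemma padicValRat_prod_zpow {q : ι → ℕ} (hq : ∀ i, (q i).Prime) (hinj : Function.Injective q)
    (k : ι → ℤ) (i : ι) : padicValRat (q i) (∏ j, (q j : ℚ) ^ k j) = k i := by
  classical
  have := Fact.mk (hq i)
  have hne : ∀ j, (q j : ℚ) ≠ 0 := fun j => by exact_mod_cast (hq j).ne_zero
  have h : ∀ s : Finset ι, padicValRat (q i) (∏ j ∈ s, (q j : ℚ) ^ k j)
      = ∑ j ∈ s, if j = i then k j else 0 := by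
    intro s
    induction s using Finset.induction_on with
    | empty => simp
    | insert j s hj ih =>
      rw [Finset.prod_insert hj, Finset.sum_insert hj,
        padicValRat.mul (zpow_ne_zero _ (hne j))
          (Finset.prod_ne_zero_iff.2 fun j _ => zpow_ne_zero _ (hne j)), ih,
        padicValRat.zpow]
      congr 1
      rw [padicValRat.of_nat]
      split_ifs with hji
      · rw [hji, padicValNat_self]; simp
      · have := Fact.mk (hq j)
        rw [padicValNat_primes fun h => hji (hinj h).symm]; simp
  rw [h]
  simp

/-- Unique factorization in the rationals, read off from valuations. It forces every exponent to be
nonnegative as soon as the frequency is the logarithm of an integer, which is what separates the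
analytic part of a product from the rest. -/
lemma eq_padicValNat_of_sum_log_eq {q : ι → ℕ} (hq : ∀ i, (q i).Prime)
    (hinj : Function.Injective q) {k : ι → ℤ} {n : ℕ} (hn : 0 < n)
    (h : ∑ i, (k i : ℝ) * Real.log (q i) = Real.log n) (i : ι) :
    k i = padicValNat (q i) n := by
  have hpos : ∀ j, (0 : ℝ) < q j := fun j => by exact_mod_cast (hq j).pos
  have h1 : Real.log (∏ j, (q j : ℝ) ^ k j) = Real.log n := by
    rw [Real.log_prod fun j _ => zpow_ne_zero _ (hpos j).ne', ← h]
    simp [Real.log_zpow]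
  have h2 := Real.log_injOn_pos (Finset.prod_pos fun j _ => zpow_pos (hpos j) (k j))
    (show (0 : ℝ) < n by exact_mod_cast hn) h1
  have h3 : (∏ j, (q j : ℚ) ^ k j) = n := by
    apply Rat.cast_injective (α := ℝ)
    push_cast
    exact h2
  rw [← padicValRat_prod_zpow hq hinj k i, h3, padicValRat.of_nat]

/-- The exponents of the Laurent polynomials used as local factors. -/
def locExp : Fin 7 → ℤ := ![0, 1, -1, 2, -2, 3, -3]

lemma locExp_eq_zero_iff (j : Fin 7) : locExp j = 0 ↔ j = 0 := by
  fin_cases j <;> simp [locExp]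

/-- The product over `i` of the Laurent polynomials with coefficients `c i`, evaluated at
`q i ^ (i t)`. -/
def trigProd (q : ι → ℕ) (c : ι → Fin 7 → ℝ) (t : ℝ) : ℂ :=
  ∏ i, ∑ j, (c i j : ℂ) * meanExp (Real.log (q i)) t ^ locExp j

/-- The frequency attached to a choice of exponents. -/
def logFreq (q : ι → ℕ) (k : ι → Fin 7) : ℝ := ∑ i, (locExp (k i) : ℝ) * Real.log (q i)

lemma prod_pow_pos {q : ι → ℕ} (hq : ∀ i, (q i).Prime) (k : ι → ℕ) : 0 < ∏ i, q i ^ k i :=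
  Finset.prod_pos fun i _ => pow_pos (hq i).pos _

lemma log_prod_pow {q : ι → ℕ} (hq : ∀ i, (q i).Prime) {k : ι → Fin 7} (hk : ∀ i, 0 ≤ locExp (k i)) :
    Real.log ((∏ i, q i ^ (locExp (k i)).toNat : ℕ) : ℝ) = logFreq q k := by
  push_cast
  rw [Real.log_prod fun i _ => pow_ne_zero _ (by exact_mod_cast (hq i).ne_zero), logFreq]
  refine Finset.sum_congr rfl fun i _ => ?_
  rw [Real.log_pow]
  congr 1
  have := Int.toNat_of_nonneg (hk i)
  exact_mod_cast this

variable [DecidableEq ι]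

open Classical in
/-- The coefficient of `n ^ (i t)` in `trigProd q c t`. -/
def trigCoeff (q : ι → ℕ) (c : ι → Fin 7 → ℝ) (n : ℕ) : ℝ :=
  ∑ k : ι → Fin 7, if logFreq q k = Real.log n then ∏ i, c i (k i) else 0

lemma trigProd_eq_sum (q : ι → ℕ) (c : ι → Fin 7 → ℝ) (t : ℝ) :
    trigProd q c t = ∑ k : ι → Fin 7, ((∏ i, c i (k i) : ℝ) : ℂ) * meanExp (logFreq q k) t := by
  rw [trigProd, Finset.prod_univ_sum, Fintype.piFinset_univ]
  refine Finset.sum_congr rfl fun k _ => ?_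
  rw [Finset.prod_mul_distrib, logFreq, meanExp_sum]
  push_cast
  simp_rw [meanExp_int_mul]

lemma continuous_trigProd (q : ι → ℕ) (c : ι → Fin 7 → ℝ) : Continuous (trigProd q c) := by
  simp_rw [funext (trigProd_eq_sum q c)]
  exact continuous_finsetSum _ fun k _ => continuous_const.mul (continuous_meanExp _)

lemma hasMean_mul_trigProd (q : ι → ℕ) (c : ι → Fin 7 → ℝ) (n : ℕ) :
    HasMean (fun t => meanExp (-Real.log n) t * trigProd q c t) (trigCoeff q c n) := by
  classical
  have h : (fun t => meanExp (-Real.log n) t * trigProd q c t) = fun t =>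
      ∑ k : ι → Fin 7, ((∏ i, c i (k i) : ℝ) : ℂ) * meanExp (logFreq q k - Real.log n) t := by
    ext t
    rw [trigProd_eq_sum, Finset.mul_sum]
    refine Finset.sum_congr rfl fun k _ => ?_
    rw [sub_eq_add_neg, meanExp_add]
    ring
  rw [h]
  have h2 : ((trigCoeff q c n : ℝ) : ℂ) = ∑ k : ι → Fin 7, ((∏ i, c i (k i) : ℝ) : ℂ) *
      (if logFreq q k - Real.log n = 0 then 1 else 0) := by
    simp only [trigCoeff, sub_eq_zero]
    rw [Complex.ofReal_sum]
    refine Finset.sum_congr rfl fun k _ => ?_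
    split_ifs <;> simp
  rw [h2]
  exact hasMean_finsetSum _ (fun k _ => continuous_const.mul (continuous_meanExp _))
    fun k _ => HasMean.const_mul (tendsto_mean_meanExp _) _


lemma trigCoeff_one {q : ι → ℕ} (hq : ∀ i, (q i).Prime) (hinj : Function.Injective q)
    (c : ι → Fin 7 → ℝ) : trigCoeff q c 1 = ∏ i, c i 0 := by
  rw [trigCoeff, Finset.sum_eq_single (fun _ => 0)]
  · simp [logFreq, locExp]
  · intro k _ hk
    rw [if_neg]
    intro h
    refine hk (funext fun i => (locExp_eq_zero_iff _).1 ?_)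
    have := eq_padicValNat_of_sum_log_eq hq hinj one_pos h i
    simpa using this
  · simp

lemma hasMean_trigProd {q : ι → ℕ} (hq : ∀ i, (q i).Prime) (hinj : Function.Injective q)
    (c : ι → Fin 7 → ℝ) : HasMean (trigProd q c) (∏ i, c i 0 : ℝ) := by
  have := hasMean_mul_trigProd q c 1
  rw [trigCoeff_one hq hinj] at this
  simpa [meanExp_zero] using this

lemma trigCoeff_nonneg {q : ι → ℕ} (hq : ∀ i, (q i).Prime) (hinj : Function.Injective q)
    {c : ι → Fin 7 → ℝ} (hc : ∀ i j, 0 ≤ locExp j → 0 ≤ c i j) {n : ℕ}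
    (hn : 0 < n) : 0 ≤ trigCoeff q c n := by
  refine Finset.sum_nonneg fun k _ => ?_
  split_ifs with h
  · refine Finset.prod_nonneg fun i _ => hc i _ ?_
    rw [eq_padicValNat_of_sum_log_eq hq hinj hn h i]
    positivity
  · exact le_rfl

/-- The integers whose powers `n ^ (i t)` may occur in `trigProd q c t`. -/
def trigSupport {q : ι → ℕ} (hq : ∀ i, (q i).Prime) : Finset ℕ+ :=
  Finset.univ.image fun k : ι → Fin 7 =>
    (⟨∏ i, q i ^ (locExp (k i)).toNat, prod_pow_pos hq _⟩ : ℕ+)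

lemma trigCoeff_eq_zero {q : ι → ℕ} (hq : ∀ i, (q i).Prime) (hinj : Function.Injective q)
    (c : ι → Fin 7 → ℝ) {n : ℕ+} (hn : n ∉ trigSupport hq) :
    trigCoeff q c n = 0 := by
  -- `toNat` in `trigSupport` truncates negative exponents, but a choice `k` with frequency `log n`
  -- has none, so it does produce `n` itself.
  refine Finset.sum_eq_zero fun k _ => if_neg fun h => hn ?_
  have hk : ∀ i, 0 ≤ locExp (k i) := fun i => by
    rw [eq_padicValNat_of_sum_log_eq hq hinj n.pos h i]
    positivity
  rw [← log_prod_pow hq hk] at h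
  exact Finset.mem_image.2 ⟨k, Finset.mem_univ _,
    PNat.eq (nat_eq_of_log_eq (prod_pow_pos hq _) n.pos h)⟩

/-- The analytic part is again an Euler product: a choice with all exponents nonnegative contributes
to exactly one integer, and a choice with a negative exponent to none. -/
lemma sum_trigCoeff_mul_rpow {q : ι → ℕ} (hq : ∀ i, (q i).Prime) (hinj : Function.Injective q)
    (c : ι → Fin 7 → ℝ) (σ : ℝ) :
    ∑ n ∈ trigSupport hq, trigCoeff q c n * ((n : ℕ) : ℝ) ^ (-σ)
      = ∏ i, ∑ j, if 0 ≤ locExp j then c i j * ((q i : ℝ) ^ (-σ)) ^ locExp j else 0 := by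
  rw [Finset.prod_univ_sum, Fintype.piFinset_univ]
  simp_rw [trigCoeff, Finset.sum_mul]
  rw [Finset.sum_comm]
  refine Finset.sum_congr rfl fun k _ => ?_
  by_cases hk : ∀ i, 0 ≤ locExp (k i)
  · obtain ⟨m, hmem, hm⟩ : ∃ m ∈ trigSupport hq, (m : ℕ) = ∏ i, q i ^ (locExp (k i)).toNat :=
      ⟨_, Finset.mem_image.2 ⟨k, Finset.mem_univ _, rfl⟩, rfl⟩
    refine (Finset.sum_eq_single_of_mem _ hmem ?_).trans ?_
    · intro n _ hn
      rw [if_neg, zero_mul]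
      intro h
      rw [← log_prod_pow hq hk] at h
      exact hn (PNat.eq (hm.trans (nat_eq_of_log_eq (prod_pow_pos hq _) n.pos h)).symm)
    · rw [hm, if_pos (log_prod_pow hq hk).symm]
      simp only [hk, if_true, Finset.prod_mul_distrib]
      congr 1
      push_cast
      rw [← Real.finsetProd_rpow _ _ fun i _ => by positivity]
      refine Finset.prod_congr rfl fun i _ => ?_
      obtain ⟨m, hm⟩ := Int.eq_ofNat_of_zero_le (hk i)
      rw [hm, Int.toNat_natCast, zpow_natCast, ← Real.rpow_natCast, ← Real.rpow_natCast,
        ← Real.rpow_mul (by positivity), ← Real.rpow_mul (by positivity), mul_comm]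
  · push Not at hk
    obtain ⟨i, hi⟩ := hk
    have h0 : ∏ i, (if 0 ≤ locExp (k i) then c i (k i) * ((q i : ℝ) ^ (-σ)) ^ locExp (k i) else 0)
        = 0 := Finset.prod_eq_zero (Finset.mem_univ i) (if_neg (not_le.2 hi))
    rw [h0]
    refine Finset.sum_eq_zero fun n _ => ?_
    rw [if_neg, zero_mul]
    intro h
    rw [eq_padicValNat_of_sum_log_eq hq hinj n.pos h i] at hi
    exact absurd hi (by simp)


end

/-! ### Pairing elements of `H^p` with a trigonometric product -/

noncomputable section

lemma integral_meanMeasure {E : Type*} [NormedAddCommGroup E] [NormedSpace ℝ E] (f : ℝ → E)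
    {T : ℝ} (hT : 0 < T) : ∫ t, f t ∂meanMeasure T = (1 / T) • ∫ t in (0 : ℝ)..T, f t := by
  rw [meanMeasure, integral_smul_measure, ENNReal.toReal_ofReal (by positivity),
    intervalIntegral.integral_of_le hT.le]

lemma Continuous.integrable_meanMeasure {E : Type*} [NormedAddCommGroup E] {f : ℝ → E}
    (hf : Continuous f) (T : ℝ) : Integrable f (meanMeasure T) := by
  refine Integrable.smul_measure ?_ ENNReal.ofReal_ne_top
  exact hf.integrableOn_Ioc

/-- Hölder's inequality without a conjugate exponent, so that `r = 1`, which is the case `p = 1`,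
needs no separate treatment. -/
lemma integral_rpow_mul_rpow_le {α : Type*} [MeasurableSpace α] {μ : Measure α} {f g : α → ℝ}
    (hf : Integrable f μ) (hg : Integrable g μ) (hf0 : ∀ x, 0 ≤ f x) (hg0 : ∀ x, 0 ≤ g x)
    {r : ℝ} (hr0 : 0 ≤ r) (hr1 : r ≤ 1) :
    ∫ x, f x ^ r * g x ^ (1 - r) ∂μ ≤ (∫ x, f x ∂μ) ^ r * (∫ x, g x ∂μ) ^ (1 - r) := by
  have h := ENNReal.lintegral_mul_norm_pow_le (μ := μ)
    (f := fun x => ENNReal.ofReal (f x)) (g := fun x => ENNReal.ofReal (g x))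
    hf.1.aemeasurable.ennreal_ofReal hg.1.aemeasurable.ennreal_ofReal hr0 (sub_nonneg.2 hr1)
    (by ring)
  have hfi : 0 ≤ ∫ x, f x ∂μ := integral_nonneg hf0
  have hgi : 0 ≤ ∫ x, g x ∂μ := integral_nonneg hg0
  rw [← ofReal_integral_eq_lintegral_ofReal hf (Eventually.of_forall hf0),
    ← ofReal_integral_eq_lintegral_ofReal hg (Eventually.of_forall hg0),
    ENNReal.ofReal_rpow_of_nonneg hfi hr0, ENNReal.ofReal_rpow_of_nonneg hgi (sub_nonneg.2 hr1),
    ← ENNReal.ofReal_mul (Real.rpow_nonneg hfi _)] at h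
  have h2 : ∀ x, ENNReal.ofReal (f x) ^ r * ENNReal.ofReal (g x) ^ (1 - r)
      = ENNReal.ofReal (f x ^ r * g x ^ (1 - r)) := fun x => by
    rw [ENNReal.ofReal_rpow_of_nonneg (hf0 x) hr0,
      ENNReal.ofReal_rpow_of_nonneg (hg0 x) (sub_nonneg.2 hr1),
      ← ENNReal.ofReal_mul (Real.rpow_nonneg (hf0 x) _)]
  simp_rw [h2] at h
  have h3 : AEStronglyMeasurable (fun x => f x ^ r * g x ^ (1 - r)) μ :=
    ((hf.1.aemeasurable.pow_const r).mul (hg.1.aemeasurable.pow_const _)).aestronglyMeasurable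
  rw [integral_eq_lintegral_of_nonneg_ae (Eventually.of_forall fun x =>
    mul_nonneg (Real.rpow_nonneg (hf0 x) _) (Real.rpow_nonneg (hg0 x) _)) h3]
  exact ENNReal.toReal_le_of_le_ofReal (mul_nonneg (Real.rpow_nonneg hfi _)
    (Real.rpow_nonneg hgi _)) h

lemma norm_mean_mul_le {p : ℝ} (hp : 1 ≤ p) (P : ℕ+ →₀ ℂ) {g : ℝ → ℂ} (hg : Continuous g)
    {V : ℝ → ℝ} (hV : Continuous V) (hV0 : ∀ t, 0 ≤ V t) {K : ℝ} (hK : 0 ≤ K)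
    (hgV : ∀ t, ‖g t‖ ≤ K * V t ^ (1 - 1 / p)) {T : ℝ} (hT : 0 < T) :
    ‖((1 / T : ℝ) : ℂ) * ∫ t in (0 : ℝ)..T, dirEval P ((t : ℂ) * Complex.I) * g t‖
      ≤ K * (dirMean p P T ^ (1 / p) * (1 / T * ∫ t in (0 : ℝ)..T, V t) ^ (1 - 1 / p)) := by
  have hp0 : 0 < p := by linarith
  have hr1 : 1 / p ≤ 1 := by rw [div_le_one hp0]; exact hp
  have hP := continuous_dirEval_I P
  have h1 := integral_meanMeasure (fun t => dirEval P ((t : ℂ) * Complex.I) * g t) hT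
  rw [Complex.real_smul] at h1
  rw [← h1]
  have hc : Continuous fun t : ℝ =>
      (‖dirEval P ((t : ℂ) * Complex.I)‖ ^ p) ^ (1 / p) * V t ^ (1 - 1 / p) :=
    ((hP.norm.rpow_const fun _ => Or.inr hp0.le).rpow_const fun _ => Or.inr (by positivity)).mul
      (hV.rpow_const fun _ => Or.inr (sub_nonneg.2 hr1))
  calc _ ≤ ∫ t, ‖dirEval P ((t : ℂ) * Complex.I) * g t‖ ∂meanMeasure T :=
        norm_integral_le_integral_norm _
    _ ≤ ∫ t, K * ((‖dirEval P ((t : ℂ) * Complex.I)‖ ^ p) ^ (1 / p) * V t ^ (1 - 1 / p))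
          ∂meanMeasure T := by
        refine integral_mono ((hP.mul hg).norm.integrable_meanMeasure T)
          ((continuous_const.mul hc).integrable_meanMeasure T) fun t => ?_
        simp only [norm_mul]
        rw [← Real.rpow_mul (norm_nonneg _), mul_one_div_cancel hp0.ne', Real.rpow_one]
        calc _ ≤ ‖dirEval P ((t : ℂ) * Complex.I)‖ * (K * V t ^ (1 - 1 / p)) := by
              gcongr; exact hgV t
          _ = _ := by ring
    _ ≤ _ := by
        rw [integral_const_mul]
        refine mul_le_mul_of_nonneg_left ?_ hK
        have h2 := integral_rpow_mul_rpow_le (μ := meanMeasure T)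
          (f := fun t : ℝ => ‖dirEval P ((t : ℂ) * Complex.I)‖ ^ p) (g := V)
          ((hP.norm.rpow_const fun _ => Or.inr hp0.le).integrable_meanMeasure T)
          (hV.integrable_meanMeasure T) (fun t => by positivity) hV0
          (r := 1 / p) (by positivity) hr1
        rwa [integral_meanMeasure (fun t : ℝ => ‖dirEval P ((t : ℂ) * Complex.I)‖ ^ p) hT,
          integral_meanMeasure V hT, smul_eq_mul, smul_eq_mul] at h2

lemma dirEval_eq_sum_meanExp (P : ℕ+ →₀ ℂ) (t : ℝ) :
    dirEval P ((t : ℂ) * Complex.I) = ∑ n ∈ P.support, P n * meanExp (-Real.log (n : ℕ)) t := by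
  refine Finset.sum_congr rfl fun n _ => ?_
  have hn : (((n : ℕ) : ℂ)) ≠ 0 := by simp
  change P n * _ = _
  rw [Complex.cpow_def_of_ne_zero hn, Complex.natCast_log.symm, meanExp]
  congr 2
  push_cast
  ring

variable {ι : Type*} [Fintype ι] [DecidableEq ι]

lemma hasMean_dirEval_mul_trigProd {q : ι → ℕ} (hq : ∀ i, (q i).Prime)
    (hinj : Function.Injective q) (c : ι → Fin 7 → ℝ) (P : ℕ+ →₀ ℂ) :
    HasMean (fun t => dirEval P ((t : ℂ) * Complex.I) * trigProd q c t)
      (∑ n ∈ trigSupport hq, (trigCoeff q c n : ℂ) * P n) := by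
  have h : (fun t : ℝ => dirEval P ((t : ℂ) * Complex.I) * trigProd q c t) = fun t =>
      ∑ n ∈ P.support, P n * (meanExp (-Real.log (n : ℕ)) t * trigProd q c t) := by
    ext t
    rw [dirEval_eq_sum_meanExp, Finset.sum_mul]
    exact Finset.sum_congr rfl fun n _ => by ring
  have h2 : ∑ n ∈ trigSupport hq, (trigCoeff q c n : ℂ) * P n
      = ∑ n ∈ P.support, P n * (trigCoeff q c n : ℂ) := by
    calc _ = ∑ n ∈ trigSupport hq ∪ P.support, (trigCoeff q c n : ℂ) * P n :=
          Finset.sum_subset Finset.subset_union_left fun n _ hn => by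
            rw [trigCoeff_eq_zero hq hinj c hn]
            simp
      _ = ∑ n ∈ P.support, (trigCoeff q c n : ℂ) * P n :=
          (Finset.sum_subset Finset.subset_union_right fun n _ hn => by
            rw [Finsupp.notMem_support_iff.1 hn, mul_zero]).symm
      _ = _ := Finset.sum_congr rfl fun n _ => mul_comm _ _
  rw [h, h2]
  exact hasMean_finsetSum _
    (fun n _ => continuous_const.mul ((continuous_meanExp _).mul (continuous_trigProd q c)))
    fun n _ => (hasMean_mul_trigProd q c n).const_mul _

/-- For a Dirichlet polynomial the sum is the mean of `P(it) G(t)`, and Hölder applies. Both sides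
are continuous in `F` because the sum is finite, so density gives all of `H^p`. The majorant `V`
plays the role of `|G|^{p'}`. -/
lemma norm_sum_trigCoeff_mul_coeff_le {p : ℝ} [hp : Fact (1 ≤ p)] {q : ι → ℕ}
    (hq : ∀ i, (q i).Prime) (hinj : Function.Injective q) (c : ι → Fin 7 → ℝ)
    {V : ℝ → ℝ} (hV : Continuous V) (hV0 : ∀ t, 0 ≤ V t) {v : ℝ}
    (hVv : Tendsto (fun T : ℝ => 1 / T * ∫ t in (0 : ℝ)..T, V t) atTop (𝓝 v))
    {K : ℝ} (hK : 0 ≤ K) (hgV : ∀ t, ‖trigProd q c t‖ ≤ K * V t ^ (1 - 1 / p))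
    (F : DirHardy p) :
    ‖∑ n ∈ trigSupport hq, (trigCoeff q c n : ℂ) * DirHardy.coeff n F‖
      ≤ K * v ^ (1 - 1 / p) * ‖F‖ := by
  have hp0 : 0 < p := by linarith [hp.out]
  have hr1 : 1 / p ≤ 1 := by rw [div_le_one hp0]; exact hp.out
  induction F using UniformSpace.Completion.induction_on with
  | hp =>
    exact isClosed_le (by fun_prop) (by fun_prop)
  | ih P =>
    rw [UniformSpace.Completion.norm_coe]
    simp_rw [DirHardy.coeff_coe]
    have h1 := hasMean_dirEval_mul_trigProd hq hinj c (DirPoly.coeffs p P)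
    have h2 := (tendsto_dirMean_rpow p hp0.le (DirPoly.coeffs p P)).mul
      (hVv.rpow_const (p := 1 - 1 / p) (Or.inr (sub_nonneg.2 hr1)))
    have h3 := le_of_tendsto_of_tendsto (Tendsto.norm h1) (h2.const_mul K) (by
      filter_upwards [eventually_gt_atTop 0] with T hT
      exact norm_mean_mul_le hp.out _ (continuous_trigProd q c) hV hV0 hK hgV hT)
    refine h3.trans (le_of_eq ?_)
    change K * (dirNorm p P * _) = K * _ * dirNorm p P
    ring

end

/-! ### Euler products as Dirichlet polynomials -/

noncomputable section

lemma dirNorm_le_of_rpow_le {p : ℝ} (hp : 1 ≤ p) (P : ℕ+ →₀ ℂ) {U : ℝ → ℝ} (hU : Continuous U)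
    (hPU : ∀ t : ℝ, ‖dirEval P ((t : ℂ) * Complex.I)‖ ^ p ≤ U t) {u : ℝ}
    (hUu : Tendsto (fun T : ℝ => 1 / T * ∫ t in (0 : ℝ)..T, U t) atTop (𝓝 u)) :
    dirNorm p P ≤ u ^ (1 / p) := by
  have hp0 : 0 < p := by linarith
  refine le_of_tendsto_of_tendsto (tendsto_dirMean_rpow p hp0.le P)
    (hUu.rpow_const (p := 1 / p) (Or.inr (by positivity))) ?_
  filter_upwards [eventually_gt_atTop 0] with T hT
  refine Real.rpow_le_rpow (dirMean_nonneg p P hT) ?_ (by positivity)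
  rw [dirMean]
  gcongr
  refine intervalIntegral.integral_mono_on hT.le ?_ (hU.intervalIntegrable _ _) fun t _ => hPU t
  exact ((continuous_dirEval_I P).norm.rpow_const fun _ => Or.inr hp0.le).intervalIntegrable _ _

lemma dirEval_single (n : ℕ+) (c s : ℂ) :
    dirEval (Finsupp.single n c) s = c * ((n : ℕ) : ℂ) ^ (-s) := by
  simp [dirEval]

lemma dirEval_sum {κ : Type*} (s : Finset κ) (f : κ → ℕ+ →₀ ℂ) (z : ℂ) :
    dirEval (∑ k ∈ s, f k) z = ∑ k ∈ s, dirEval (f k) z := by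
  classical
  induction s using Finset.induction_on with
  | empty => simp [dirEval]
  | insert k s hk ih => rw [Finset.sum_insert hk, Finset.sum_insert hk, dirEval_add, ih]

lemma dirNorm_single_one_le {p : ℝ} (hp : 1 ≤ p) : dirNorm p (Finsupp.single 1 1) ≤ 1 := by
  have h := dirNorm_le_of_rpow_le hp (Finsupp.single 1 1) (U := fun _ => 1) continuous_const
    (fun t => by simp [dirEval_single]) (u := 1)
    ((tendsto_const_nhds (x := (1 : ℝ))).congr' (by
      filter_upwards [eventually_gt_atTop 0] with T hT
      simp [hT.ne']))
  simpa using h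

lemma natCast_prod_cpow {κ : Type*} (A : Finset κ) (f : κ → ℕ) (s : ℂ) :
    ((∏ i ∈ A, f i : ℕ) : ℂ) ^ s = ∏ i ∈ A, (f i : ℂ) ^ s := by
  classical
  induction A using Finset.induction_on with
  | empty => simp
  | insert i A hi ih =>
    rw [Finset.prod_insert hi, Finset.prod_insert hi, Nat.cast_mul,
      Complex.natCast_mul_natCast_cpow, ih]

variable {ι : Type*} [Fintype ι] [DecidableEq ι]

/-- The primes `q i` as positive natural numbers. -/
def primePNat {q : ι → ℕ} (hq : ∀ i, (q i).Prime) (i : ι) : ℕ+ := ⟨q i, (hq i).pos⟩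

/-- The coefficient sequence of `∏ i, (1 + a (q i)^(-1/2) (q i)^(-s)) - 1`. -/
def eulerPoly {q : ι → ℕ} (hq : ∀ i, (q i).Prime) (a : ℝ) : ℕ+ →₀ ℂ :=
  ∑ A ∈ (Finset.univ : Finset ι).powerset.erase ∅,
    Finsupp.single (∏ i ∈ A, primePNat hq i)
      (∏ i ∈ A, ((a * (q i : ℝ) ^ (-(1 / 2) : ℝ) : ℝ) : ℂ))

lemma dirEval_eulerPoly {q : ι → ℕ} (hq : ∀ i, (q i).Prime) (a : ℝ) (s : ℂ) :
    dirEval (eulerPoly hq a) s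
      = ∏ i, (1 + ((a * (q i : ℝ) ^ (-(1 / 2) : ℝ) : ℝ) : ℂ) * (q i : ℂ) ^ (-s)) - 1 := by
  rw [Finset.prod_one_add, ← Finset.add_sum_erase _ _ (Finset.empty_mem_powerset _), eulerPoly,
    dirEval_sum]
  simp only [Finset.prod_empty, add_sub_cancel_left]
  refine Finset.sum_congr rfl fun A _ => ?_
  rw [dirEval_single, Finset.prod_mul_distrib]
  congr 1
  rw [Finset.PNat.coe_prod, natCast_prod_cpow]
  rfl

lemma eulerPoly_apply_one {q : ι → ℕ} (hq : ∀ i, (q i).Prime) (a : ℝ) :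
    eulerPoly hq a 1 = 0 := by
  rw [eulerPoly, Finsupp.finsetSum_apply]
  refine Finset.sum_eq_zero fun A hA => Finsupp.single_eq_of_ne ?_
  obtain ⟨i, hi⟩ := Finset.nonempty_iff_ne_empty.2 (Finset.ne_of_mem_erase hA)
  intro h
  have h2 : ((∏ i ∈ A, primePNat hq i : ℕ+) : ℕ) = ∏ i ∈ A, q i :=
    Finset.PNat.coe_prod _ _
  rw [← h] at h2
  have h3 : q i ∣ 1 := by
    have := Finset.dvd_prod_of_mem q hi
    rwa [← h2] at this
  exact (hq i).one_lt.ne' (Nat.dvd_one.1 h3)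

lemma dirEval_eulerPoly_ofReal {q : ι → ℕ} (hq : ∀ i, (q i).Prime) (a w : ℝ) :
    dirEval (eulerPoly hq a) w
      = ((∏ i, (1 + a * (q i : ℝ) ^ (-(1 / 2) : ℝ) * (q i : ℝ) ^ (-w)) - 1 : ℝ) : ℂ) := by
  rw [dirEval_eulerPoly]
  push_cast
  congr 1
  refine Finset.prod_congr rfl fun i _ => ?_
  rw [Complex.ofReal_cpow (by positivity), Complex.ofReal_cpow (by positivity)]
  push_cast
  rfl

end

/-! ### Laurent polynomials on the unit circle -/

noncomputable section

lemma meanExp_eq_cos_add_sin (l t : ℝ) :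
    meanExp l t = (Real.cos (l * t) : ℂ) + (Real.sin (l * t) : ℂ) * Complex.I := by
  rw [meanExp, ← Complex.ofReal_mul, Complex.exp_mul_I, Complex.ofReal_cos, Complex.ofReal_sin]

lemma meanExp_inv_eq (l t : ℝ) :
    (meanExp l t)⁻¹ = (Real.cos (l * t) : ℂ) - (Real.sin (l * t) : ℂ) * Complex.I := by
  have h : (meanExp l t)⁻¹ = meanExp (-l) t := by
    rw [meanExp, meanExp, ← Complex.exp_neg]
    congr 1
    push_cast
    ring
  rw [h, meanExp_eq_cos_add_sin, neg_mul, Real.cos_neg, Real.sin_neg]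
  push_cast
  ring

lemma sum_locExp (c : Fin 7 → ℝ) (z : ℂ) :
    ∑ j, (c j : ℂ) * z ^ locExp j = c 0 + c 1 * z + c 2 * z⁻¹ + c 3 * z ^ 2 + c 4 * z⁻¹ ^ 2
      + c 5 * z ^ 3 + c 6 * z⁻¹ ^ 3 := by
  have h2 : z ^ (-2 : ℤ) = z⁻¹ ^ 2 := by rw [zpow_neg, inv_pow]; rfl
  have h3 : z ^ (-3 : ℤ) = z⁻¹ ^ 3 := by rw [zpow_neg, inv_pow]; rfl
  have h2' : z ^ (2 : ℤ) = z ^ 2 := rfl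
  have h3' : z ^ (3 : ℤ) = z ^ 3 := rfl
  rw [Fin.sum_univ_seven]
  simp [locExp, h2, h3, h2', h3']

lemma sq_sin_cast (θ : ℝ) : (Real.sin θ : ℂ) ^ 2 = 1 - (Real.cos θ : ℂ) ^ 2 := by
  have := Real.sin_sq θ
  exact_mod_cast this

/-- The coefficients of the Laurent polynomial equal to `A + B cos θ + D cos² θ` on the unit
circle. -/
def cosQuadCoeff (A B D : ℝ) : Fin 7 → ℝ := ![A + D / 2, B / 2, B / 2, D / 4, D / 4, 0, 0]

lemma sum_cosQuadCoeff (A B D l t : ℝ) :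
    ∑ j, (cosQuadCoeff A B D j : ℂ) * meanExp l t ^ locExp j
      = ((A + B * Real.cos (l * t) + D * Real.cos (l * t) ^ 2 : ℝ) : ℂ) := by
  rw [sum_locExp, meanExp_inv_eq, meanExp_eq_cos_add_sin]
  have h := sq_sin_cast (l * t)
  have hI := Complex.I_sq
  simp only [cosQuadCoeff, Matrix.cons_val]
  push_cast at h ⊢
  linear_combination (-(D : ℂ) / 2) * h
    + (D : ℂ) / 2 * Complex.sin (l * t) ^ 2 * hI

/-- The coefficients of the Laurent polynomial equal to
`(1 + i x sin θ - x² sin² θ / 2) (1 + b x cos θ)` on the unit circle. -/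
def dualCoeff (b x : ℝ) : Fin 7 → ℝ :=
  ![1 - x ^ 2 / 4, x / 2 + b * x / 2 - b * x ^ 3 / 16, -x / 2 + b * x / 2 - b * x ^ 3 / 16,
    x ^ 2 / 8 + b * x ^ 2 / 4, x ^ 2 / 8 - b * x ^ 2 / 4, b * x ^ 3 / 16, b * x ^ 3 / 16]

/-- The first factor is the second order truncation of `e^{i x sin θ}`. The whole has degree three,
hence seven exponents. -/
lemma sum_dualCoeff (b x l t : ℝ) :
    ∑ j, (dualCoeff b x j : ℂ) * meanExp l t ^ locExp j
      = (((1 - x ^ 2 * Real.sin (l * t) ^ 2 / 2 : ℝ) : ℂ)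
          + ((x * Real.sin (l * t) : ℝ) : ℂ) * Complex.I)
        * ((1 + b * x * Real.cos (l * t) : ℝ) : ℂ) := by
  rw [sum_locExp, meanExp_inv_eq, meanExp_eq_cos_add_sin]
  have h := sq_sin_cast (l * t)
  have hI := Complex.I_sq
  simp only [dualCoeff, Matrix.cons_val]
  push_cast at h ⊢
  generalize Complex.sin (l * t) = S at *
  generalize Complex.cos (l * t) = C at *
  linear_combination ((x : ℂ) ^ 2 / 4 + (x : ℂ) ^ 3 * b * C / 8) * h
    + ((x : ℂ) ^ 2 * S ^ 2 / 4 + 3 * (x : ℂ) ^ 3 * b * C * S ^ 2 / 8) * hI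

/-- With `s = sin θ`, the truncated exponential satisfies `|1 - x² s²/2 + i x s|² = 1 + x⁴ s⁴/4`: it
is unimodular up to fourth order, negligible against `x²`. -/
lemma norm_sum_dualCoeff_le {b x l t : ℝ} (hbx : 0 ≤ 1 + b * x * Real.cos (l * t)) :
    ‖∑ j, (dualCoeff b x j : ℂ) * meanExp l t ^ locExp j‖
      ≤ (1 + x ^ 4) * (1 + b * x * Real.cos (l * t)) := by
  rw [sum_dualCoeff, norm_mul, Complex.norm_real, Real.norm_of_nonneg hbx]
  gcongr
  rw [Complex.norm_add_mul_I]
  refine Real.sqrt_le_iff.2 ⟨by positivity, ?_⟩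
  have h1 := Real.sin_sq_le_one (l * t)
  have h2 := sq_nonneg (Real.sin (l * t))
  generalize Real.sin (l * t) = S at *
  have h3 : S ^ 4 ≤ 1 := by nlinarith
  have h4 : x ^ 4 * S ^ 4 ≤ x ^ 4 := mul_le_of_le_one_right (by positivity) h3
  have h5 : 0 ≤ x ^ 4 := by positivity
  nlinarith [sq_nonneg (x ^ 4)]

end

/-! ### Dirichlet coefficients of the transform -/

noncomputable section

lemma norm_dirEval_le {P : ℕ+ →₀ ℂ} {w : ℂ} (hw : 0 ≤ w.re) :
    ‖dirEval P w‖ ≤ ∑ n ∈ P.support, ‖P n‖ := by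
  refine (norm_sum_le _ _).trans (Finset.sum_le_sum fun n _ => ?_)
  rw [norm_mul, Complex.norm_natCast_cpow_of_pos n.pos]
  refine mul_le_of_le_one_right (norm_nonneg _)
    (Real.rpow_le_one_of_one_le_of_nonpos (by exact_mod_cast n.pos) (by simpa using hw))

lemma continuous_dirEval (P : ℕ+ →₀ ℂ) : Continuous (dirEval P) := by
  unfold dirEval Finsupp.sum
  refine continuous_finsetSum _ fun n _ => continuous_const.mul ?_
  exact continuous_neg.const_cpow (Or.inl (by simp))

/-- The coefficient of `n^{-s}` in the Dirichlet series of the transform of `P`. -/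
def hilbertCoeff (P : ℕ+ →₀ ℂ) (n : ℕ) : ℂ :=
  ∫ w in Set.Ioi (1 / 2 : ℝ), dirEval P w * (n : ℂ) ^ (-(w : ℂ))

lemma norm_dirEval_mul_cpow_le (P : ℕ+ →₀ ℂ) {n : ℕ} (hn : 2 ≤ n) {w : ℝ} (hw : 1 / 2 < w) :
    ‖dirEval P w * (n : ℂ) ^ (-(w : ℂ))‖
      ≤ (∑ n ∈ P.support, ‖P n‖) * Real.exp (-Real.log 2 * w) := by
  rw [norm_mul, Complex.norm_natCast_cpow_of_pos (by omega)]
  gcongr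
  · exact norm_dirEval_le (by simp; linarith)
  · rw [Real.rpow_def_of_pos (by positivity)]
    refine Real.exp_le_exp.2 ?_
    have : Real.log 2 ≤ Real.log n := Real.log_le_log (by norm_num) (by exact_mod_cast hn)
    simp only [Complex.neg_re, Complex.ofReal_re]
    nlinarith

lemma continuous_dirEval_mul_cpow (P : ℕ+ →₀ ℂ) {n : ℕ} (hn : n ≠ 0) :
    Continuous fun w : ℝ => dirEval P w * (n : ℂ) ^ (-(w : ℂ)) :=
  ((continuous_dirEval P).comp Complex.continuous_ofReal).mul
    ((Complex.continuous_ofReal.neg).const_cpow (Or.inl (by exact_mod_cast hn)))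

lemma integrableOn_dirEval_mul_cpow (P : ℕ+ →₀ ℂ) {n : ℕ} (hn : 2 ≤ n) :
    IntegrableOn (fun w : ℝ => dirEval P w * (n : ℂ) ^ (-(w : ℂ))) (Set.Ioi (1 / 2)) := by
  refine Integrable.mono' ((exp_neg_integrableOn_Ioi (1 / 2)
    (Real.log_pos one_lt_two)).const_mul (∑ n ∈ P.support, ‖P n‖))
    (continuous_dirEval_mul_cpow P (by omega)).aestronglyMeasurable ?_
  filter_upwards [self_mem_ae_restrict measurableSet_Ioi] with w hw
  exact norm_dirEval_mul_cpow_le P hn hw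

/-- A bound for the coefficients of the transform of `P`. -/
def hilbertBound (P : ℕ+ →₀ ℂ) : ℝ :=
  ∫ w in Set.Ioi (1 / 2 : ℝ), (∑ n ∈ P.support, ‖P n‖) * Real.exp (-Real.log 2 * w)

lemma integral_norm_dirEval_mul_cpow_le (P : ℕ+ →₀ ℂ) {n : ℕ} (hn : 2 ≤ n) :
    ∫ w in Set.Ioi (1 / 2 : ℝ), ‖dirEval P w * (n : ℂ) ^ (-(w : ℂ))‖ ≤ hilbertBound P := by
  refine setIntegral_mono_on (integrableOn_dirEval_mul_cpow P hn).norm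
    ((exp_neg_integrableOn_Ioi (1 / 2) (Real.log_pos one_lt_two)).const_mul _) measurableSet_Ioi
    fun w hw => norm_dirEval_mul_cpow_le P hn hw

lemma norm_hilbertCoeff_le (P : ℕ+ →₀ ℂ) {n : ℕ} (hn : 2 ≤ n) :
    ‖hilbertCoeff P n‖ ≤ hilbertBound P :=
  (norm_integral_le_integral_norm _).trans (integral_norm_dirEval_mul_cpow_le P hn)

lemma riemannZeta_sub_one {s : ℂ} (hs : 1 < s.re) :
    riemannZeta s - 1 = ∑' n : ℕ, ((n + 2 : ℕ) : ℂ) ^ (-s) := by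
  have hsum : Summable fun n : ℕ => 1 / ((n : ℂ) + 1) ^ s := by
    have := (summable_nat_add_iff 1).2 (Complex.summable_one_div_nat_cpow.2 hs)
    simpa using this
  rw [zeta_eq_tsum_one_div_nat_add_one_cpow hs, hsum.tsum_eq_zero_add]
  simp only [Nat.cast_zero, zero_add, Complex.one_cpow, div_one, add_sub_cancel_left]
  refine tsum_congr fun n => ?_
  rw [Complex.cpow_neg, one_div]
  push_cast
  ring_nf

/-- Expand `ζ(w + s) - 1` and integrate termwise; the uniform bound on the coefficient integrals
makes this absolutely convergent for `Re s > 1`. -/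
lemma hasSum_mulHilbert (P : ℕ+ →₀ ℂ) {s : ℂ} (hs : 1 < s.re) :
    HasSum (fun n : ℕ => hilbertCoeff P (n + 2) * ((n + 2 : ℕ) : ℂ) ^ (-s))
      (mulHilbert (dirEval P) s) := by
  have h := hasSum_integral_of_summable_integral_norm
    (μ := volume.restrict (Set.Ioi (1 / 2 : ℝ)))
    (F := fun (n : ℕ) (w : ℝ) => dirEval P w * ((n + 2 : ℕ) : ℂ) ^ (-(w : ℂ)) *
      ((n + 2 : ℕ) : ℂ) ^ (-s))
    (fun n => (integrableOn_dirEval_mul_cpow P (by omega)).mul_const _) ?_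
  · have h2 : mulHilbert (dirEval P) s = ∫ w in Set.Ioi (1 / 2 : ℝ), ∑' n : ℕ,
        dirEval P w * ((n + 2 : ℕ) : ℂ) ^ (-(w : ℂ)) * ((n + 2 : ℕ) : ℂ) ^ (-s) := by
      refine setIntegral_congr_fun measurableSet_Ioi fun w hw => ?_
      have hw' : (1 / 2 : ℝ) < w := hw
      rw [riemannZeta_sub_one (by simp; linarith), ← tsum_mul_left]
      refine tsum_congr fun n => ?_
      rw [mul_assoc, ← Complex.cpow_add _ _ (Nat.cast_ne_zero.2 (by omega)), neg_add]
    rw [h2]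
    exact h.congr_fun fun n => (integral_mul_const _ _).symm
  · have hsum : Summable fun n : ℕ => hilbertBound P * ((n + 2 : ℕ) : ℝ) ^ (-s.re) :=
      ((summable_nat_add_iff 2).2 (Real.summable_nat_rpow.2 (by linarith))).mul_left _
    refine Summable.of_nonneg_of_le (fun n => integral_nonneg fun w => norm_nonneg
      (dirEval P w * ((n + 2 : ℕ) : ℂ) ^ (-(w : ℂ)) * ((n + 2 : ℕ) : ℂ) ^ (-s))) (fun n => ?_) hsum
    simp_rw [norm_mul _ (((n + 2 : ℕ) : ℂ) ^ (-s))]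
    rw [integral_mul_const, Complex.norm_natCast_cpow_of_pos (by omega), Complex.neg_re]
    gcongr
    exact integral_norm_dirEval_mul_cpow_le P (by omega)

lemma DirHardy.norm_coeff_le {p : ℝ} [hp : Fact (1 ≤ p)] (n : ℕ+) (F : DirHardy p) :
    ‖DirHardy.coeff n F‖ ≤ ‖F‖ := by
  induction F using UniformSpace.Completion.induction_on with
  | hp => exact isClosed_le (by fun_prop) (by fun_prop)
  | ih P =>
    rw [DirHardy.coeff_coe, UniformSpace.Completion.norm_coe]
    exact _root_.norm_coeff_le p hp.out P n

/-- The Dirichlet coefficients of `F`, extended by zero. -/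
def DirHardy.coeffSeq {p : ℝ} [Fact (1 ≤ p)] (F : DirHardy p) (n : ℕ) : ℂ :=
  if h : 0 < n then DirHardy.coeff ⟨n, h⟩ F else 0

lemma DirHardy.toFun_eq_LSeries {p : ℝ} [Fact (1 ≤ p)] (F : DirHardy p) (s : ℂ) :
    DirHardy.toFun F s = LSeries (DirHardy.coeffSeq F) s := by
  rw [LSeries, ← PNat.coe_injective.tsum_eq, DirHardy.toFun]
  · refine tsum_congr fun n => ?_
    rw [LSeries.term_of_ne_zero n.ne_zero, DirHardy.coeffSeq, dif_pos n.pos, Complex.cpow_neg,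
      div_eq_mul_inv]
    rfl
  · intro n hn
    have hn0 : n ≠ 0 := by
      rintro rfl
      simp at hn
    exact ⟨⟨n, Nat.pos_of_ne_zero hn0⟩, rfl⟩

/-- Uniqueness of Dirichlet coefficients: both series have bounded coefficients, and it suffices
that they agree at real `s > 1`, where termwise integration is available. -/
lemma DirHardy.coeff_eq_hilbertCoeff {p : ℝ} [hp : Fact (1 ≤ p)] {F : DirHardy p} {P : ℕ+ →₀ ℂ}
    (h : ∀ s : ℂ, 1 / 2 < s.re → DirHardy.toFun F s = mulHilbert (dirEval P) s)
    {n : ℕ+} (hn : n ≠ 1) : DirHardy.coeff n F = hilbertCoeff P n := by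
  let B : ℕ → ℂ := fun n => if n < 2 then 0 else hilbertCoeff P n
  have hA : LSeries.abscissaOfAbsConv (DirHardy.coeffSeq F) < ⊤ :=
    (LSeries.abscissaOfAbsConv_le_of_le_const ⟨‖F‖, fun n hn => by
      rw [DirHardy.coeffSeq, dif_pos (Nat.pos_of_ne_zero hn)]
      exact DirHardy.norm_coeff_le _ F⟩).trans_lt (by exact_mod_cast EReal.coe_lt_top 1)
  have hB : LSeries.abscissaOfAbsConv B < ⊤ :=
    (LSeries.abscissaOfAbsConv_le_of_le_const ⟨|hilbertBound P|, fun n hn => by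
      by_cases h2 : n < 2
      · simp only [B, h2, if_true, norm_zero]
        exact abs_nonneg _
      · simp only [B, h2, if_false]
        exact (norm_hilbertCoeff_le P (by omega)).trans (le_abs_self _)⟩).trans_lt
      (by exact_mod_cast EReal.coe_lt_top 1)
  have hAB : (fun x : ℝ => LSeries (DirHardy.coeffSeq F) x) =ᶠ[atTop] fun x => LSeries B x := by
    filter_upwards [eventually_gt_atTop 1] with x hx
    rw [← DirHardy.toFun_eq_LSeries, h x (by simp; linarith)]
    have h1 := hasSum_mulHilbert P (s := x) (by simpa using hx)
    have h2 : HasSum (fun n => LSeries.term B x (n + 2)) (mulHilbert (dirEval P) x) := by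
      convert h1 using 2 with n
      rw [LSeries.term_of_ne_zero (by omega), Complex.cpow_neg, div_eq_mul_inv]
      simp [B]
    have h3 := (hasSum_nat_add_iff 2).1 h2
    rw [Finset.sum_range_succ, Finset.sum_range_one] at h3
    have h4 := h3.tsum_eq
    rw [LSeries, h4]
    simp [LSeries.term, B]
  have key := LSeries.eq_of_LSeries_eventually_eq hA hB hAB n.ne_zero
  have hn2 : ¬ (n : ℕ) < 2 := by
    have := n.pos
    have : (n : ℕ) ≠ 1 := fun h => hn (PNat.eq h)
    omega
  rw [DirHardy.coeffSeq, dif_pos n.pos] at key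
  simp only [B, hn2, if_false] at key
  exact key

end

/-! ### Estimates for the local factors -/

noncomputable section

lemma exists_cosQuad_norm_bound {p : ℝ} (hp : 1 ≤ p) {ε : ℝ} (hε : 0 < ε) :
    ∃ X > 0, ∀ x : ℝ, 0 < x → x ^ 2 ≤ X → ∃ A B D : ℝ,
      A + D / 2 ≤ Real.exp ((1 + ε) * x ^ 2) ∧
      ∀ θ : ℝ, (1 + 2 * (2 / p * x) * Real.cos θ + (2 / p * x) ^ 2) ^ (p / 2)
        ≤ A + B * Real.cos θ + D * Real.cos θ ^ 2 := by
  have hp0 : 0 < p := by linarith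
  set a : ℝ := 2 / p with ha
  have ha0 : 0 < a := by positivity
  have hap : a * p = 2 := by rw [ha]; field_simp
  set ε₀ : ℝ := ε / (4 * a ^ 2) with hε₀
  have hε₀0 : 0 < ε₀ := by positivity
  have hε₀a : a ^ 2 * ε₀ = ε / 4 := by rw [hε₀]; field_simp
  obtain ⟨η, hη, hbound⟩ := exists_one_add_rpow_le (p / 2) hε₀0
  set s : ℝ := p / 2 * (p / 2 - 1) / 2 + ε₀ with hs
  have h1 : ∀ᶠ x : ℝ in 𝓝 0, 2 * (a * |x|) + a ^ 2 * x ^ 2 < η := by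
    have : Continuous fun x : ℝ => 2 * (a * |x|) + a ^ 2 * x ^ 2 := by fun_prop
    exact (this.tendsto 0).eventually_lt_const (by simpa using hη)
  have h2 : ∀ᶠ x : ℝ in 𝓝 0, s * a ^ 4 * x ^ 2 < ε / 2 := by
    have : Continuous fun x : ℝ => s * a ^ 4 * x ^ 2 := by fun_prop
    exact (this.tendsto 0).eventually_lt_const (by simpa using hε)
  obtain ⟨r, hr, hball⟩ := Metric.eventually_nhds_iff.1 (h1.and h2)
  refine ⟨(r / 2) ^ 2, by positivity, fun x hx hxr => ?_⟩
  have hxr' : x ≤ r / 2 := le_of_sq_le_sq hxr (by positivity)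
  obtain ⟨hx1, hx2⟩ := hball (y := x) (by
    rw [dist_zero_right, Real.norm_of_nonneg hx.le]; linarith)
  rw [abs_of_pos hx] at hx1
  refine ⟨1 + p / 2 * a ^ 2 * x ^ 2 + s * a ^ 4 * x ^ 4, p * a * x + 4 * s * a ^ 3 * x ^ 3,
    4 * s * a ^ 2 * x ^ 2, ?_, fun θ => ?_⟩
  -- `A + D/2` is the mean over `θ`. Apart from `ε₀`, its `x²` coefficient is `a² p² / 4`, equal to
  -- `1` by the choice `a = 2/p`.
  · have h3 : 1 + p / 2 * a ^ 2 * x ^ 2 + s * a ^ 4 * x ^ 4 + 4 * s * a ^ 2 * x ^ 2 / 2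
        = 1 + (1 + 2 * (a ^ 2 * ε₀) + s * a ^ 4 * x ^ 2) * x ^ 2 := by
      rw [hs]
      linear_combination (x ^ 2 * (a * p + 2) / 4) * hap
    rw [h3, hε₀a]
    have h4 := Real.add_one_le_exp ((1 + ε) * x ^ 2)
    have h5 : (1 + 2 * (ε / 4) + s * a ^ 4 * x ^ 2) * x ^ 2 ≤ (1 + ε) * x ^ 2 :=
      mul_le_mul_of_nonneg_right (by linarith) (sq_nonneg x)
    linarith
  · have hc := Real.abs_cos_le_one θ
    have h3 := hbound (2 * (a * x) * Real.cos θ + (a * x) ^ 2) (by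
      refine (abs_add_le _ _).trans ?_
      rw [abs_mul, abs_of_nonneg (show 0 ≤ 2 * (a * x) by positivity),
        abs_of_nonneg (sq_nonneg (a * x))]
      have : 2 * (a * x) * |Real.cos θ| ≤ 2 * (a * x) * 1 := by gcongr
      nlinarith)
    rw [← add_assoc] at h3
    refine h3.trans (le_of_eq ?_)
    ring

lemma exists_cosQuad_dual_bound {p : ℝ} (hp : 1 ≤ p) {ε : ℝ} (hε : 0 < ε) :
    ∃ X > 0, ∀ x : ℝ, 0 < x → x ^ 2 ≤ X → ∃ A B D : ℝ,
      0 ≤ A + D / 2 ∧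
      (A + D / 2) ^ (1 - 1 / p) ≤ Real.exp (((p - 1) / 4 + ε) * x ^ 2) ∧
      ∀ θ : ℝ, 0 ≤ 1 + (p - 1) * x * Real.cos θ ∧
        0 ≤ A + B * Real.cos θ + D * Real.cos θ ^ 2 ∧
        1 + (p - 1) * x * Real.cos θ
          ≤ (A + B * Real.cos θ + D * Real.cos θ ^ 2) ^ (1 - 1 / p) := by
  have hp0 : 0 < p := by linarith
  -- For `p = 1` the conjugate exponent is infinite, but the cosine term vanishes and constants
  -- suffice.
  rcases hp.eq_or_lt with rfl | hp1
  · refine ⟨1, one_pos, fun x _ _ => ⟨1, 0, 0, by norm_num, ?_, fun θ => by norm_num⟩⟩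
    norm_num
    positivity
  set b : ℝ := p - 1 with hb
  have hb0 : 0 < b := by linarith
  set p' : ℝ := p / b with hp'
  set ε₀ : ℝ := ε / b ^ 2 with hε₀
  have hε₀0 : 0 < ε₀ := by positivity
  have hε₀b : b ^ 2 * ε₀ = ε := by rw [hε₀]; field_simp
  have hpb : p' * b = p := by rw [hp']; field_simp
  have hp'1 : (p' - 1) * b = 1 := by rw [sub_mul, hpb, hb]; ring
  have hp'0 : 0 < p' := by positivity
  have hinv : p' * (1 - 1 / p) = 1 := by
    rw [hp']; field_simp; rw [hb]
  have hr0 : 0 ≤ 1 - 1 / p := by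
    rw [sub_nonneg, div_le_one hp0]; exact hp
  have hr1 : 1 - 1 / p ≤ 1 := by
    have : 0 ≤ 1 / p := by positivity
    linarith
  obtain ⟨η, hη, hbound⟩ := exists_one_add_rpow_le p' hε₀0
  set s : ℝ := p' * (p' - 1) / 2 + ε₀ with hs
  -- Hence the mean is `1 + (p/4 + ε/2) x²`, whose power `1 - 1/p` has leading exponent `(p-1)/4`.
  have hsb : s * b ^ 2 = p / 2 + ε := by
    rw [hs]
    linear_combination hε₀b + (p' - 1) * b / 2 * hpb + p / 2 * hp'1
  have hs0 : 0 ≤ s := by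
    by_contra h
    have : s * b ^ 2 < 0 := mul_neg_of_neg_of_pos (not_le.1 h) (by positivity)
    rw [hsb] at this
    linarith
  set m : ℝ := min η 1 with hm
  have hm0 : 0 < m := by positivity
  refine ⟨(m / b) ^ 2, by positivity, fun x hx hxr => ?_⟩
  have hxr' : b * x ≤ m := by
    have := le_of_sq_le_sq hxr (by positivity)
    rwa [le_div_iff₀ hb0, mul_comm] at this
  refine ⟨1, p' * b * x, s * b ^ 2 * x ^ 2, by positivity, ?_, fun θ => ?_⟩
  · have h1 : 1 + s * b ^ 2 * x ^ 2 / 2 ≤ Real.exp ((p / 4 + ε / 2) * x ^ 2) := by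
      rw [hsb]
      have := Real.add_one_le_exp ((p / 4 + ε / 2) * x ^ 2)
      linarith
    refine (Real.rpow_le_rpow (by positivity) h1 hr0).trans ?_
    rw [← Real.exp_mul, Real.exp_le_exp]
    have h2 : (p / 4 + ε / 2) * x ^ 2 * (1 - 1 / p)
        = (b / 4 + ε / 2 * (1 - 1 / p)) * x ^ 2 := by
      rw [hb]; field_simp
    rw [h2]
    gcongr
    nlinarith
  · have hc := Real.abs_cos_le_one θ
    have hv : |b * x * Real.cos θ| ≤ m := by
      rw [abs_mul, abs_of_pos (show 0 < b * x by positivity)]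
      calc b * x * |Real.cos θ| ≤ b * x * 1 := by gcongr
        _ ≤ m := by linarith
    have h0 : 0 ≤ 1 + b * x * Real.cos θ := by
      have := (abs_le.1 (hv.trans (min_le_right η 1))).1
      linarith
    have h1 := hbound _ (hv.trans (min_le_left _ _))
    have h2 : 1 + p' * (b * x * Real.cos θ) + s * (b * x * Real.cos θ) ^ 2
        = 1 + p' * b * x * Real.cos θ + s * b ^ 2 * x ^ 2 * Real.cos θ ^ 2 := by ring
    rw [h2] at h1
    refine ⟨h0, (Real.rpow_nonneg h0 _).trans h1, ?_⟩
    calc 1 + b * x * Real.cos θ = ((1 + b * x * Real.cos θ) ^ p') ^ (1 - 1 / p) := by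
          rw [← Real.rpow_mul h0, hinv, Real.rpow_one]
      _ ≤ _ := Real.rpow_le_rpow (Real.rpow_nonneg h0 _) h1 hr0

/-- Bounds a factor of `P(1/2 + δ)` from below, with `u = q^(-δ)` close to `1`. -/
lemma exists_exp_le_linear_factor {a ε : ℝ} (ha : 0 ≤ a) (hε : 0 < ε) :
    ∃ η > 0, ∃ X > 0, ∀ x u : ℝ, 0 < x → x ^ 2 ≤ X → 1 - η ≤ u → u ≤ 1 →
      Real.exp ((a - ε) * x ^ 2) ≤ 1 + a * x * (x * u) := by
  obtain ⟨X, hX, h⟩ := exists_exp_mul_le_one_add (show a - ε < a - ε / 2 by linarith)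
  refine ⟨ε / (2 * (a + 1)), by positivity, X, hX, fun x u hx hxX hu _ =>
    (h _ (sq_nonneg x) hxX).trans ?_⟩
  have h1 : a * (ε / (2 * (a + 1))) ≤ ε / 2 := by
    rw [mul_div_assoc', div_le_div_iff₀ (by positivity) (by positivity)]
    nlinarith
  have h2 : a - ε / 2 ≤ a * u := by nlinarith
  nlinarith [sq_nonneg x]

lemma dualCoeff_nonneg {b x : ℝ} (hb : 0 ≤ b) (hx : 0 ≤ x) (hx1 : x ≤ 1) {j : Fin 7}
    (hj : 0 ≤ locExp j) : 0 ≤ dualCoeff b x j := by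
  have h2 : x ^ 2 ≤ 1 := pow_le_one₀ hx hx1
  have h3 : b * x ^ 3 ≤ b * x := by
    have : x ^ 3 ≤ x := pow_le_of_le_one hx hx1 (by norm_num)
    gcongr
  have hbx : 0 ≤ b * x := by positivity
  fin_cases j <;> simp only [locExp, dualCoeff, Fin.zero_eta, Fin.mk_one, Fin.reduceFinMk,
    Matrix.cons_val] at hj ⊢
  · linarith
  · linarith
  · omega
  · positivity
  · omega
  · positivity
  · omega

lemma exists_exp_le_dual_factor {p ε : ℝ} (hp : 1 ≤ p) (hε : 0 < ε) :
    ∃ η > 0, ∃ X > 0, ∀ x u : ℝ, 0 < x → x ^ 2 ≤ X → 1 - η ≤ u → 0 ≤ u → u ≤ 1 →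
      Real.exp ((p / 2 - 1 / 4 - ε) * x ^ 2)
        ≤ ∑ j, if 0 ≤ locExp j then dualCoeff (p - 1) x j * (x * u) ^ locExp j else 0 := by
  obtain ⟨X, hX, h⟩ := exists_exp_mul_le_one_add
    (show p / 2 - 1 / 4 - ε < p / 2 - 1 / 4 - ε / 2 by linarith)
  -- The choice of `η` makes `(p/2)(1 - u) ≤ ε/4` and the bound `x² ≤ 4ε/p` makes the cubic
  -- correction at most `ε/4` of `x²`; together they use up `ε/2`.
  refine ⟨ε / (2 * p), by positivity, min (min X 1) (4 * ε / p), by positivity,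
    fun x u hx hxX hu hu0 hu1 => (h _ (sq_nonneg x)
      (hxX.trans ((min_le_left _ _).trans (min_le_left _ _)))).trans ?_⟩
  have hx2 : x ^ 2 ≤ 1 := hxX.trans ((min_le_left _ _).trans (min_le_right _ _))
  have hx1 : x ≤ 1 := by nlinarith
  have hxε : p * x ^ 2 ≤ 4 * ε := by
    have := hxX.trans (min_le_right _ _)
    rwa [le_div_iff₀ (by linarith), mul_comm] at this
  -- The exponents `0` and `1` already give the required order; the others contribute nonnegatively.
  have h1 : ∑ j ∈ {0, 1}, (if 0 ≤ locExp j then dualCoeff (p - 1) x j * (x * u) ^ locExp j else 0)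
      ≤ ∑ j, if 0 ≤ locExp j then dualCoeff (p - 1) x j * (x * u) ^ locExp j else 0 := by
    refine Finset.sum_le_univ_sum_of_nonneg fun j => ?_
    split_ifs with hj
    · exact mul_nonneg (dualCoeff_nonneg (by linarith) hx.le hx1 hj) (by positivity)
    · exact le_rfl
  refine le_trans ?_ h1
  rw [Finset.sum_pair (by simp)]
  have e0 : locExp 0 = 0 := rfl
  have e1 : locExp 1 = 1 := rfl
  have d0 : dualCoeff (p - 1) x 0 = 1 - x ^ 2 / 4 := rfl
  have d1 : dualCoeff (p - 1) x 1 = x / 2 + (p - 1) * x / 2 - (p - 1) * x ^ 3 / 16 := rfl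
  rw [e0, e1, d0, d1, if_pos le_rfl, if_pos zero_le_one, zpow_zero, zpow_one]
  have h2 : p * (1 - u) ≤ ε / 2 := by
    have : p * (1 - u) ≤ p * (ε / (2 * p)) := by gcongr; linarith
    refine this.trans (le_of_eq ?_)
    field_simp
  have h3 : (p - 1) * x ^ 2 * u ≤ 4 * ε := by
    calc (p - 1) * x ^ 2 * u ≤ p * x ^ 2 * 1 := by gcongr; linarith
      _ ≤ _ := by linarith
  have h4 : p / 2 - 1 / 4 - ε / 2 ≤ -1 / 4 + p / 2 * u - (p - 1) * x ^ 2 * u / 16 := by linarith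
  nlinarith [mul_le_mul_of_nonneg_right h4 (sq_nonneg x)]

end

/-! ### The inequality forced by a bounded extension -/

noncomputable section

variable {ι : Type*} [Fintype ι]

/-- The product over `i` of `A i + B i cos θ + D i cos² θ`, `θ = t log (q i)`. -/
def cosQuadProd (q : ι → ℕ) (A B D : ι → ℝ) (t : ℝ) : ℝ :=
  ∏ i, (A i + B i * Real.cos (Real.log (q i) * t) + D i * Real.cos (Real.log (q i) * t) ^ 2)

lemma continuous_cosQuadProd (q : ι → ℕ) (A B D : ι → ℝ) : Continuous (cosQuadProd q A B D) := by
  unfold cosQuadProd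
  fun_prop

/-- The value of `∏ i, (1 + a (q i)^(-1/2) (q i)^(-w)) - 1` at a real point. -/
def eulerVal (q : ι → ℕ) (a w : ℝ) : ℝ :=
  ∏ i, (1 + a * (q i : ℝ) ^ (-(1 / 2) : ℝ) * (q i : ℝ) ^ (-w)) - 1

lemma eulerVal_nonneg (q : ι → ℕ) {a : ℝ} (ha : 0 ≤ a) (w : ℝ) : 0 ≤ eulerVal q a w := by
  rw [eulerVal, sub_nonneg]
  exact Finset.one_le_prod fun i _ => by
    have : 0 ≤ a * (q i : ℝ) ^ (-(1 / 2) : ℝ) * (q i : ℝ) ^ (-w) := by positivity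
    linarith

lemma eulerVal_antitone {q : ι → ℕ} (hq : ∀ i, (q i).Prime) {a : ℝ} (ha : 0 ≤ a) :
    Antitone (eulerVal q a) := by
  intro v w hvw
  rw [eulerVal, eulerVal]
  gcongr with i
  exact_mod_cast (hq i).one_lt.le

variable [DecidableEq ι]

/-- The mean keeps only the zero frequency, so it is the product of the constant Laurent
coefficients. -/
lemma tendsto_mean_cosQuadProd {q : ι → ℕ} (hq : ∀ i, (q i).Prime) (hinj : Function.Injective q)
    (A B D : ι → ℝ) :
    Tendsto (fun T : ℝ => 1 / T * ∫ t in (0 : ℝ)..T, cosQuadProd q A B D t) atTop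
      (𝓝 (∏ i, (A i + D i / 2))) := by
  refine HasMean.tendsto_real ?_
  have h := hasMean_trigProd hq hinj fun i => cosQuadCoeff (A i) (B i) (D i)
  have h2 : trigProd q (fun i => cosQuadCoeff (A i) (B i) (D i))
      = fun t => (cosQuadProd q A B D t : ℂ) := by
    ext t
    rw [trigProd, cosQuadProd, Complex.ofReal_prod]
    exact Finset.prod_congr rfl fun i _ => sum_cosQuadCoeff _ _ _ _ _
  rwa [h2] at h

lemma norm_one_add_mul_meanExp_sq (y l t : ℝ) :
    ‖1 + (y : ℂ) * meanExp (-l) t‖ ^ 2 = 1 + 2 * y * Real.cos (l * t) + y ^ 2 := by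
  have h : 1 + (y : ℂ) * meanExp (-l) t
      = ((1 + y * Real.cos (l * t) : ℝ) : ℂ) + ((-(y * Real.sin (l * t)) : ℝ) : ℂ) * Complex.I := by
    rw [meanExp_eq_cos_add_sin, neg_mul, Real.cos_neg, Real.sin_neg]
    push_cast
    ring
  rw [h, Complex.sq_norm, Complex.normSq_add_mul_I]
  linear_combination y ^ 2 * Real.sin_sq_add_cos_sq (l * t)

lemma dirNorm_eulerPoly_le {p : ℝ} (hp : 1 ≤ p) {q : ι → ℕ} (hq : ∀ i, (q i).Prime)
    (hinj : Function.Injective q) (a : ℝ) {A B D : ι → ℝ}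
    (h : ∀ i θ, (1 + 2 * (a * (q i : ℝ) ^ (-(1 / 2) : ℝ)) * Real.cos θ
        + (a * (q i : ℝ) ^ (-(1 / 2) : ℝ)) ^ 2) ^ (p / 2)
      ≤ A i + B i * Real.cos θ + D i * Real.cos θ ^ 2) :
    dirNorm p (eulerPoly hq a) ≤ (∏ i, (A i + D i / 2)) ^ (1 / p) + 1 := by
  have h1 : dirNorm p (eulerPoly hq a + Finsupp.single 1 1) ≤ (∏ i, (A i + D i / 2)) ^ (1 / p) := by
    refine dirNorm_le_of_rpow_le hp _ (continuous_cosQuadProd q A B D) (fun t => ?_)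
      (tendsto_mean_cosQuadProd hq hinj A B D)
    rw [dirEval_add, dirEval_eulerPoly, dirEval_single]
    simp only [PNat.one_coe, Nat.cast_one, Complex.one_cpow, mul_one, sub_add_cancel]
    rw [norm_prod, ← Real.finsetProd_rpow _ _ fun i _ => norm_nonneg _, cosQuadProd]
    refine Finset.prod_le_prod (fun i _ => Real.rpow_nonneg (norm_nonneg _) _) fun i _ => ?_
    have h2 : (q i : ℂ) ^ (-((t : ℂ) * Complex.I)) = meanExp (-Real.log (q i)) t := by
      rw [Complex.cpow_def_of_ne_zero (by exact_mod_cast (hq i).ne_zero),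
        Complex.natCast_log.symm, meanExp]
      congr 1
      push_cast
      ring
    refine le_trans (le_of_eq ?_) (h i (Real.log (q i) * t))
    rw [h2, ← norm_one_add_mul_meanExp_sq, ← Real.rpow_natCast, ← Real.rpow_mul (norm_nonneg _)]
    congr 1
    push_cast
    ring
  have h2 : eulerPoly hq a
      = (eulerPoly hq a + Finsupp.single 1 1) + (-1 : ℂ) • Finsupp.single 1 1 := by
    simp
  rw [h2]
  refine (dirNorm_add_le p hp _ _).trans (add_le_add h1 ?_)
  rw [dirNorm_smul p hp]
  simpa using dirNorm_single_one_le hp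

/-- The integrand is nonnegative and decreasing in `w`: restrict to an interval of length `δ` and
use the value at its right end. -/
lemma le_re_hilbertCoeff_eulerPoly {q : ι → ℕ} (hq : ∀ i, (q i).Prime) {a : ℝ} (ha : 0 ≤ a)
    {n : ℕ} (hn : 2 ≤ n) {δ : ℝ} (hδ : 0 ≤ δ) :
    δ * eulerVal q a (1 / 2 + δ) * (n : ℝ) ^ (-(1 / 2 + δ))
      ≤ (hilbertCoeff (eulerPoly hq a) n).re := by
  have hreal : ∀ w : ℝ, dirEval (eulerPoly hq a) w * (n : ℂ) ^ (-(w : ℂ))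
      = ((eulerVal q a w * (n : ℝ) ^ (-w) : ℝ) : ℂ) := fun w => by
    rw [dirEval_eulerPoly_ofReal, eulerVal, Complex.ofReal_mul,
      Complex.ofReal_cpow (Nat.cast_nonneg n)]
    push_cast
    rfl
  have hint := integrableOn_dirEval_mul_cpow (eulerPoly hq a) hn
  simp_rw [hreal] at hint
  have hint' : IntegrableOn (fun w : ℝ => eulerVal q a w * (n : ℝ) ^ (-w))
      (Set.Ioi (1 / 2)) := hint.re
  rw [hilbertCoeff]
  simp_rw [hreal]
  rw [integral_complex_ofReal, Complex.ofReal_re]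
  have hn1 : (1 : ℝ) ≤ n := by exact_mod_cast (by omega : 1 ≤ n)
  calc δ * eulerVal q a (1 / 2 + δ) * (n : ℝ) ^ (-(1 / 2 + δ))
      = ∫ _ in Set.Ioc (1 / 2 : ℝ) (1 / 2 + δ),
          eulerVal q a (1 / 2 + δ) * (n : ℝ) ^ (-(1 / 2 + δ)) := by
        rw [setIntegral_const, Measure.real, Real.volume_Ioc, add_sub_cancel_left,
          ENNReal.toReal_ofReal hδ, smul_eq_mul, mul_assoc]
    _ ≤ ∫ w in Set.Ioc (1 / 2 : ℝ) (1 / 2 + δ), eulerVal q a w * (n : ℝ) ^ (-w) := by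
        refine setIntegral_mono_on (integrableOn_const (by simp))
          (hint'.mono_set Set.Ioc_subset_Ioi_self) measurableSet_Ioc fun w hw => ?_
        gcongr
        · exact eulerVal_nonneg q ha w
        · exact eulerVal_antitone hq ha hw.2
        · exact hw.2
    _ ≤ _ := setIntegral_mono_set hint' (Eventually.of_forall fun w =>
        mul_nonneg (eulerVal_nonneg q ha w) (by positivity))
        (LE.le.eventuallyLE Set.Ioc_subset_Ioi_self)

lemma hilbert_operator_inequality {p : ℝ} [hp : Fact (1 ≤ p)]
    (T : DirHardyZero p →L[ℂ] DirHardyZero p)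
    (hT : ∀ (P : DirPoly p) (hP : (P : DirHardy p) ∈ DirHardyZero p) (s : ℂ), 1 / 2 < s.re →
        DirHardy.toFun (T ⟨(P : DirHardy p), hP⟩ : DirHardy p) s = mulHilbert P.eval s)
    {q : ι → ℕ} (hq : ∀ i, (q i).Prime) (hinj : Function.Injective q) {a : ℝ} (ha : 0 ≤ a)
    {c : ι → Fin 7 → ℝ} (hc : ∀ i j, 0 ≤ locExp j → 0 ≤ c i j)
    {K : ℝ} (hK : 0 ≤ K) {A B D : ι → ℝ} (hV0 : ∀ t, 0 ≤ cosQuadProd q A B D t)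
    (hV : ∀ t, ‖trigProd q c t‖ ≤ K * cosQuadProd q A B D t ^ (1 - 1 / p))
    (hA : ∀ i, 0 ≤ A i + D i / 2) {δ : ℝ} (hδ : 0 ≤ δ) :
    δ * eulerVal q a (1 / 2 + δ) *
      (∏ i, (∑ j, if 0 ≤ locExp j then c i j * ((q i : ℝ) ^ (-(1 / 2 + δ))) ^ locExp j else 0)
        - ∏ i, c i 0)
      ≤ K * (∏ i, (A i + D i / 2)) ^ (1 - 1 / p) * (‖T‖ * dirNorm p (eulerPoly hq a)) := by
  set P : DirPoly p := eulerPoly hq a with hPdef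
  have hP : (P : DirHardy p) ∈ DirHardyZero p := by
    change DirHardy.coeff 1 (P : DirHardy p) = 0
    rw [DirHardy.coeff_coe]
    exact eulerPoly_apply_one hq a
  set F : DirHardyZero p := T ⟨(P : DirHardy p), hP⟩ with hF
  have hcoeff : ∀ n : ℕ+, n ≠ 1 →
      DirHardy.coeff n (F : DirHardy p) = hilbertCoeff (eulerPoly hq a) n := fun n hn =>
    DirHardy.coeff_eq_hilbertCoeff (fun s hs => hT P hP s hs) hn
  have hcoeff1 : DirHardy.coeff 1 (F : DirHardy p) = 0 := F.2
  have hFn : ‖(F : DirHardy p)‖ ≤ ‖T‖ * dirNorm p (eulerPoly hq a) := by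
    have := T.le_opNorm ⟨(P : DirHardy p), hP⟩
    refine this.trans (le_of_eq ?_)
    congr 1
    exact UniformSpace.Completion.norm_coe P
  have hup := norm_sum_trigCoeff_mul_coeff_le hq hinj c (continuous_cosQuadProd q A B D) hV0
    (tendsto_mean_cosQuadProd hq hinj A B D) hK hV (F : DirHardy p)
  have hv : 0 ≤ K * (∏ i, (A i + D i / 2)) ^ (1 - 1 / p) :=
    mul_nonneg hK (Real.rpow_nonneg (Finset.prod_nonneg fun i _ => hA i) _)
  refine le_trans ?_ (hup.trans (mul_le_mul_of_nonneg_left hFn hv))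
  refine le_trans ?_ (Complex.re_le_norm _)
  have hone : (1 : ℕ+) ∈ trigSupport hq :=
    Finset.mem_image.2 ⟨fun _ => 0, Finset.mem_univ _, PNat.eq (by
      change ∏ i, q i ^ (locExp 0).toNat = 1
      simp [locExp])⟩
  -- The term `n = 1` drops out on both sides: `F` has no constant coefficient, and `∏ c i 0` is
  -- what the left side subtracts.
  rw [← sum_trigCoeff_mul_rpow hq hinj c, ← trigCoeff_one hq hinj c, Complex.re_sum,
    ← Finset.add_sum_erase _ _ hone, ← Finset.add_sum_erase _ _ hone, hcoeff1]
  simp only [PNat.one_coe, Nat.cast_one, Real.one_rpow, mul_one, add_sub_cancel_left, mul_zero,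
    Complex.zero_re, zero_add, Finset.mul_sum]
  refine Finset.sum_le_sum fun n hn => ?_
  have hn1 : n ≠ 1 := Finset.ne_of_mem_erase hn
  have hn2 : 2 ≤ (n : ℕ) := by
    have := n.pos
    have : (n : ℕ) ≠ 1 := fun h => hn1 (PNat.eq h)
    omega
  rw [hcoeff n hn1, Complex.re_ofReal_mul]
  have h1 := le_re_hilbertCoeff_eulerPoly hq ha hn2 hδ
  have h2 := trigCoeff_nonneg hq hinj hc n.pos
  calc _ = trigCoeff q c n * (δ * eulerVal q a (1 / 2 + δ) * ((n : ℕ) : ℝ) ^ (-(1 / 2 + δ))) := by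
        ring
    _ ≤ _ := mul_le_mul_of_nonneg_left h1 h2

end

/-! ### Unboundedness -/

noncomputable section

lemma exp_mul_sum_le_prod {ι : Type*} [Fintype ι] {d : ℝ} {y f : ι → ℝ}
    (h : ∀ i, Real.exp (d * y i) ≤ f i) : Real.exp (d * ∑ i, y i) ≤ ∏ i, f i := by
  rw [Finset.mul_sum, Real.exp_sum]
  exact Finset.prod_le_prod (fun i _ => (Real.exp_pos _).le) fun i _ => h i

lemma prod_le_exp_mul_sum {ι : Type*} [Fintype ι] {d : ℝ} {y f : ι → ℝ} (h0 : ∀ i, 0 ≤ f i)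
    (h : ∀ i, f i ≤ Real.exp (d * y i)) : ∏ i, f i ≤ Real.exp (d * ∑ i, y i) := by
  rw [Finset.mul_sum, Real.exp_sum]
  exact Finset.prod_le_prod (fun i _ => h0 i) fun i _ => h i

/-- The exponents balance as `2/p + (p/2 - 1/4) - (p-1)/4 - 1/p = 1/p + p/4`, with five errors `ε`.
Removing the constant terms costs a factor `2` in each of the two lower bounds and in `‖P‖`, hence
the `8`. -/
lemma mul_exp_le_of_euler_factor_bounds {ι : Type*} [Fintype ι] [DecidableEq ι] {p : ℝ}
    [hp : Fact (1 ≤ p)]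
    (T : DirHardyZero p →L[ℂ] DirHardyZero p)
    (hT : ∀ (P : DirPoly p) (hP : (P : DirHardy p) ∈ DirHardyZero p) (s : ℂ), 1 / 2 < s.re →
        DirHardy.toFun (T ⟨(P : DirHardy p), hP⟩ : DirHardy p) s = mulHilbert P.eval s)
    {q : ι → ℕ} (hq : ∀ i, (q i).Prime) (hinj : Function.Injective q) {δ ε : ℝ} (hδ : 0 ≤ δ)
    (hε : 0 < ε) {x : ι → ℝ} (hx : ∀ i, x i = (q i : ℝ) ^ (-(1 / 2) : ℝ))
    (hnorm : ∀ i, ∃ A B D : ℝ, A + D / 2 ≤ Real.exp ((1 + ε) * x i ^ 2) ∧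
      ∀ θ : ℝ, (1 + 2 * (2 / p * x i) * Real.cos θ + (2 / p * x i) ^ 2) ^ (p / 2)
        ≤ A + B * Real.cos θ + D * Real.cos θ ^ 2)
    (hdual : ∀ i, ∃ A B D : ℝ, 0 ≤ A + D / 2 ∧
      (A + D / 2) ^ (1 - 1 / p) ≤ Real.exp (((p - 1) / 4 + ε) * x i ^ 2) ∧
      ∀ θ : ℝ, 0 ≤ 1 + (p - 1) * x i * Real.cos θ ∧
        0 ≤ A + B * Real.cos θ + D * Real.cos θ ^ 2 ∧
        1 + (p - 1) * x i * Real.cos θ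
          ≤ (A + B * Real.cos θ + D * Real.cos θ ^ 2) ^ (1 - 1 / p))
    (hlin : ∀ i, Real.exp ((2 / p - ε) * x i ^ 2)
      ≤ 1 + 2 / p * x i * (x i * (q i : ℝ) ^ (-δ)))
    (hlow : ∀ i, Real.exp ((p / 2 - 1 / 4 - ε) * x i ^ 2)
      ≤ ∑ j, if 0 ≤ locExp j then
          dualCoeff (p - 1) (x i) j * (x i * (q i : ℝ) ^ (-δ)) ^ locExp j else 0)
    (hquart : ∀ i, 1 + x i ^ 4 ≤ Real.exp (ε * x i ^ 2))
    (hS1 : 2 ≤ Real.exp ((2 / p - ε) * ∑ i, x i ^ 2))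
    (hS2 : 2 ≤ Real.exp ((p / 2 - 1 / 4 - ε) * ∑ i, x i ^ 2)) :
    δ * Real.exp ((1 / p + p / 4 - 5 * ε) * ∑ i, x i ^ 2) ≤ 8 * ‖T‖ := by
  have hp1 := hp.out
  have hp0 : 0 < p := by linarith
  have hr0 : 0 ≤ 1 - 1 / p := by
    rw [sub_nonneg, div_le_one hp0]; exact hp1
  choose A B D hAD hABD using hnorm
  choose A' B' D' hA' hAD' hABD' using hdual
  have hq0 : ∀ i, (0 : ℝ) < q i := fun i => by exact_mod_cast (hq i).pos
  have hx0 : ∀ i, 0 ≤ x i := fun i => by rw [hx]; positivity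
  have hx1 : ∀ i, x i ≤ 1 := fun i => by
    rw [hx]
    exact Real.rpow_le_one_of_one_le_of_nonpos (by exact_mod_cast (hq i).one_lt.le) (by norm_num)
  have hxu : ∀ i, (q i : ℝ) ^ (-(1 / 2 + δ)) = x i * (q i : ℝ) ^ (-δ) := fun i => by
    rw [hx, ← Real.rpow_add (hq0 i), neg_add]
  set S : ℝ := ∑ i, x i ^ 2 with hS
  have hS0 : 0 ≤ S := Finset.sum_nonneg fun i _ => sq_nonneg _
  -- The quadratic majorizes a nonnegative quantity; at `cos θ = 1, -1, 0` this gives `A + B + D`,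
  -- `A - B + D` and `A`, of which `A + D/2` is a nonnegative combination.
  have hADpos : ∀ i, 0 ≤ A i + D i / 2 := fun i => by
    have hnn : ∀ θ, 0 ≤ 1 + 2 * (2 / p * x i) * Real.cos θ + (2 / p * x i) ^ 2 := fun θ => by
      nlinarith [Real.sin_sq_add_cos_sq θ, sq_nonneg (2 / p * x i * Real.sin θ),
        sq_nonneg (1 + 2 / p * x i * Real.cos θ)]
    have h1 := (Real.rpow_nonneg (hnn 0) (p / 2)).trans (hABD i 0)
    have h2 := (Real.rpow_nonneg (hnn Real.pi) (p / 2)).trans (hABD i Real.pi)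
    have h3 := (Real.rpow_nonneg (hnn (Real.pi / 2)) (p / 2)).trans (hABD i (Real.pi / 2))
    simp only [Real.cos_zero, Real.cos_pi, Real.cos_pi_div_two] at h1 h2 h3
    linarith
  have hV0 : ∀ t, 0 ≤ cosQuadProd q A' B' D' t := fun t =>
    Finset.prod_nonneg fun i _ => (hABD' i _).2.1
  have hV : ∀ t, ‖trigProd q (fun i => dualCoeff (p - 1) (x i)) t‖
      ≤ (∏ i, (1 + x i ^ 4)) * cosQuadProd q A' B' D' t ^ (1 - 1 / p) := fun t => by
    rw [trigProd, norm_prod, cosQuadProd,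
      ← Real.finsetProd_rpow _ _ fun i _ => (hABD' i _).2.1, ← Finset.prod_mul_distrib]
    refine Finset.prod_le_prod (fun i _ => norm_nonneg _) fun i _ => ?_
    refine (norm_sum_dualCoeff_le (hABD' i _).1).trans ?_
    gcongr
    exact (hABD' i _).2.2
  have key := hilbert_operator_inequality T hT hq hinj (a := 2 / p) (by positivity)
    (c := fun i => dualCoeff (p - 1) (x i))
    (fun i j hj => dualCoeff_nonneg (by linarith) (hx0 i) (hx1 i) hj)
    (K := ∏ i, (1 + x i ^ 4)) (Finset.prod_nonneg fun i _ => by positivity) hV0 hV hA' hδ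
  have hP := dirNorm_eulerPoly_le hp1 hq hinj (2 / p) (A := A) (B := B) (D := D) (fun i θ => by
    rw [← hx]; exact hABD i θ)
  have e1 : Real.exp ((2 / p - ε) * S) / 2 ≤ eulerVal q (2 / p) (1 / 2 + δ) := by
    have : Real.exp ((2 / p - ε) * S) ≤ eulerVal q (2 / p) (1 / 2 + δ) + 1 := by
      rw [eulerVal, sub_add_cancel]
      refine exp_mul_sum_le_prod fun i => ?_
      rw [hxu, ← hx]
      exact hlin i
    linarith
  have e2 : Real.exp ((p / 2 - 1 / 4 - ε) * S) / 2 ≤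
      ∏ i, (∑ j, if 0 ≤ locExp j then
        dualCoeff (p - 1) (x i) j * ((q i : ℝ) ^ (-(1 / 2 + δ))) ^ locExp j else 0)
        - ∏ i, dualCoeff (p - 1) (x i) 0 := by
    have h1 : Real.exp ((p / 2 - 1 / 4 - ε) * S) ≤ ∏ i, (∑ j, if 0 ≤ locExp j then
        dualCoeff (p - 1) (x i) j * ((q i : ℝ) ^ (-(1 / 2 + δ))) ^ locExp j else 0) :=
      exp_mul_sum_le_prod fun i => by
        rw [hxu]
        exact hlow i
    have h2 : ∏ i, dualCoeff (p - 1) (x i) 0 ≤ 1 := by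
      refine Finset.prod_le_one
        (fun i _ => dualCoeff_nonneg (by linarith) (hx0 i) (hx1 i) (by simp [locExp])) fun i _ => ?_
      have : 0 ≤ x i ^ 2 := sq_nonneg _
      simp only [dualCoeff, Matrix.cons_val]
      linarith
    linarith
  have e3 : ∏ i, (1 + x i ^ 4) ≤ Real.exp (ε * S) :=
    prod_le_exp_mul_sum (fun i => by positivity) hquart
  have e4 : (∏ i, (A' i + D' i / 2)) ^ (1 - 1 / p) ≤ Real.exp (((p - 1) / 4 + ε) * S) := by
    rw [← Real.finsetProd_rpow _ _ fun i _ => hA' i]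
    exact prod_le_exp_mul_sum (fun i => Real.rpow_nonneg (hA' i) _) hAD'
  have e5 : dirNorm p (eulerPoly hq (2 / p)) ≤ 2 * Real.exp ((1 / p + ε) * S) := by
    have h1 : (∏ i, (A i + D i / 2)) ^ (1 / p) ≤ Real.exp ((1 / p + ε) * S) := by
      refine (Real.rpow_le_rpow (Finset.prod_nonneg fun i _ => hADpos i)
        (prod_le_exp_mul_sum hADpos hAD) (by positivity)).trans ?_
      rw [← Real.exp_mul, Real.exp_le_exp]
      have : (1 + ε) * S * (1 / p) = (1 / p + ε * (1 / p)) * S := by ring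
      rw [this]
      gcongr
      have : 1 / p ≤ 1 := by linarith
      nlinarith
    have h2 : 1 ≤ Real.exp ((1 / p + ε) * S) := Real.one_le_exp (by positivity)
    linarith
  have low : δ * (Real.exp ((2 / p - ε) * S) / 2) * (Real.exp ((p / 2 - 1 / 4 - ε) * S) / 2)
      ≤ Real.exp (ε * S) * Real.exp (((p - 1) / 4 + ε) * S)
        * (‖T‖ * (2 * Real.exp ((1 / p + ε) * S))) := by
    refine le_trans ?_ (key.trans ?_)
    · have := eulerVal_nonneg q (show 0 ≤ 2 / p by positivity) (1 / 2 + δ)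
      gcongr
    · have h1 := dirNorm_nonneg p hp0.le (eulerPoly hq (2 / p))
      have h2 := Real.rpow_nonneg (Finset.prod_nonneg fun i (_ : i ∈ Finset.univ) => hA' i)
        (1 - 1 / p)
      gcongr
  set E : ℝ := Real.exp (ε * S) * Real.exp (((p - 1) / 4 + ε) * S) * Real.exp ((1 / p + ε) * S)
    with hE
  have hEpos : 0 < E := by positivity
  have hsplit : Real.exp ((2 / p - ε) * S) * Real.exp ((p / 2 - 1 / 4 - ε) * S)
      = Real.exp ((1 / p + p / 4 - 5 * ε) * S) * E := by
    rw [hE, ← Real.exp_add, ← Real.exp_add, ← Real.exp_add, ← Real.exp_add]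
    congr 1
    ring
  refine le_of_mul_le_mul_right ?_ hEpos
  calc δ * Real.exp ((1 / p + p / 4 - 5 * ε) * S) * E
      = 4 * (δ * (Real.exp ((2 / p - ε) * S) / 2)
          * (Real.exp ((p / 2 - 1 / 4 - ε) * S) / 2)) := by
        rw [mul_assoc, ← hsplit]; ring
    _ ≤ 4 * _ := mul_le_mul_of_nonneg_left low (by norm_num)
    _ = 8 * ‖T‖ * E := by rw [hE]; ring

lemma tendsto_sum_primesBetween (y : ℕ) :
    Tendsto (fun N : ℕ => ∑ q ∈ primesBetween y N, 1 / (q : ℝ)) atTop atTop := by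
  obtain ⟨C, hC, h⟩ := exists_log_le_exp_sum_primesBetween y
  have h1 : Tendsto (fun N : ℕ => Real.exp (∑ q ∈ primesBetween y N, 1 / (q : ℝ))) atTop atTop := by
    refine tendsto_atTop_mono' _ ?_
      ((Real.tendsto_log_atTop.comp tendsto_natCast_atTop_atTop).atTop_div_const hC)
    filter_upwards [eventually_gt_atTop 0] with N hN
    rw [div_le_iff₀ hC, mul_comm]
    exact h N hN
  exact Real.tendsto_exp_comp_atTop.1 h1

end

theorem theorem5 (p : ℝ) [Fact (1 ≤ p)] (hp2 : p ≠ 2) :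
    ¬ ∃ T : DirHardyZero p →L[ℂ] DirHardyZero p,
      ∀ (P : DirPoly p) (hP : (P : DirHardy p) ∈ DirHardyZero p) (s : ℂ), 1 / 2 < s.re →
        DirHardy.toFun (T ⟨(P : DirHardy p), hP⟩ : DirHardy p) s = mulHilbert P.eval s := by
  rintro ⟨T, hT⟩
  have hp1 : 1 ≤ p := Fact.out
  have hp0 : 0 < p := by linarith
  set κ : ℝ := (p - 2) ^ 2 / (4 * p) with hκ
  have hκ0 : 0 < κ := div_pos (pow_two_pos_of_ne_zero (sub_ne_zero.2 hp2)) (by positivity)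
  have hκ1 : 1 / p + p / 4 = 1 + κ := by rw [hκ]; field_simp; ring
  -- `κ / 10` keeps half of the gain `κ` after losing `5ε`; `1 / 8` and `1 / p` keep `p/2 - 1/4 - ε`
  -- and `2/p - ε` positive.
  obtain ⟨ε, hε, hεκ, hε8, hεp⟩ : ∃ ε : ℝ, 0 < ε ∧ ε ≤ κ / 10 ∧ ε ≤ 1 / 8 ∧ ε ≤ 1 / p :=
    ⟨min (κ / 10) (min (1 / 8) (1 / p)), by positivity, min_le_left _ _,
      (min_le_right _ _).trans (min_le_left _ _), (min_le_right _ _).trans (min_le_right _ _)⟩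
  have h2p : 2 / p = 1 / p + 1 / p := by ring
  obtain ⟨X₁, hX₁, h₁⟩ := exists_cosQuad_norm_bound hp1 hε
  obtain ⟨X₂, hX₂, h₂⟩ := exists_cosQuad_dual_bound hp1 hε
  obtain ⟨η₃, hη₃, X₃, hX₃, h₃⟩ := exists_exp_le_linear_factor (a := 2 / p) (by positivity) hε
  obtain ⟨η₄, hη₄, X₄, hX₄, h₄⟩ := exists_exp_le_dual_factor hp1 hε
  obtain ⟨y, hy⟩ : ∃ y : ℕ, ∀ q : ℕ, y ≤ q →
      1 / (q : ℝ) < X₁ ∧ 1 / (q : ℝ) < X₂ ∧ 1 / (q : ℝ) < X₃ ∧ 1 / (q : ℝ) < X₄ ∧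
        1 / (q : ℝ) < ε := by
    have h0 := tendsto_one_div_atTop_nhds_zero_nat (𝕜 := ℝ)
    exact eventually_atTop.1 ((h0.eventually_lt_const hX₁).and ((h0.eventually_lt_const hX₂).and
      ((h0.eventually_lt_const hX₃).and ((h0.eventually_lt_const hX₄).and
        (h0.eventually_lt_const hε)))))
  obtain ⟨C, hC, hlog⟩ := exists_log_le_exp_sum_primesBetween y
  set η : ℝ := min η₃ η₄ with hη
  have hη0 : 0 < η := by positivity
  have hS := tendsto_sum_primesBetween y
  have hlarge : ∀ d c : ℝ, 0 < d → ∀ᶠ N : ℕ in atTop,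
      c < Real.exp (d * ∑ q ∈ primesBetween y N, 1 / (q : ℝ)) := fun d c hd =>
    (Real.tendsto_exp_atTop.comp (hS.const_mul_atTop hd)).eventually_gt_atTop c
  obtain ⟨N, hN1, hN2, hN3, hN4⟩ := ((hlarge (2 / p - ε) 2 (by
      have : 0 < 1 / p := by positivity
      linarith)).and ((hlarge (p / 2 - 1 / 4 - ε) 2 (by linarith)).and
    ((hlarge (κ / 2) (8 * ‖T‖ * C / η) (by positivity)).and (eventually_ge_atTop 2)))).exists
  set S : ℝ := ∑ q ∈ primesBetween y N, 1 / (q : ℝ) with hSdef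
  have hlogN : 0 < Real.log N := Real.log_pos (by exact_mod_cast (by omega : 1 < N))
  let q : primesBetween y N → ℕ := fun i => i
  have hmem : ∀ i : primesBetween y N, ((i : ℕ) < N ∧ (i : ℕ).Prime) ∧ y ≤ i := fun i => by
    have := i.2
    simpa [primesBetween, Nat.mem_primesBelow] using this
  have hq : ∀ i, (q i).Prime := fun i => (hmem i).1.2
  have hq0 : ∀ i, (0 : ℝ) < q i := fun i => by exact_mod_cast (hq i).pos
  set x : primesBetween y N → ℝ := fun i => (q i : ℝ) ^ (-(1 / 2) : ℝ) with hx
  have hx0 : ∀ i, 0 < x i := fun i => Real.rpow_pos_of_pos (hq0 i) _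
  have hxsq : ∀ i, x i ^ 2 = 1 / (q i : ℝ) := fun i => by
    rw [hx, ← Real.rpow_natCast, ← Real.rpow_mul (hq0 i).le]
    norm_num [Real.rpow_neg_one]
  have hSx : ∑ i, x i ^ 2 = S := by
    simp_rw [hxsq]
    exact Finset.sum_coe_sort (primesBetween y N) fun n : ℕ => 1 / (n : ℝ)
  -- The largest scale for which this argument gives `q^(-δ) ≥ 1 - η` at all primes `q < N`.
  set δ : ℝ := η / Real.log N with hδ
  have hδ0 : 0 < δ := by positivity
  have hu1 : ∀ i, (q i : ℝ) ^ (-δ) ≤ 1 := fun i =>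
    Real.rpow_le_one_of_one_le_of_nonpos (by exact_mod_cast (hq i).one_lt.le) (by linarith)
  have hu2 : ∀ i, 1 - η ≤ (q i : ℝ) ^ (-δ) := fun i => by
    rw [Real.rpow_def_of_pos (hq0 i)]
    have h1 : Real.log (q i) ≤ Real.log N :=
      Real.log_le_log (hq0 i) (by exact_mod_cast (hmem i).1.1.le)
    have h2 : δ * Real.log (q i) ≤ η := by
      calc δ * Real.log (q i) ≤ δ * Real.log N := by gcongr
        _ = η := by rw [hδ]; field_simp
    have := Real.add_one_le_exp (Real.log (q i) * -δ)
    linarith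
  have hu3 : ∀ i, 0 ≤ (q i : ℝ) ^ (-δ) := fun i => by positivity
  have key := mul_exp_le_of_euler_factor_bounds T hT hq Subtype.val_injective hδ0.le hε
    (x := x) (fun i => rfl)
    (fun i => h₁ (x i) (hx0 i) (by rw [hxsq]; exact (hy _ (hmem i).2).1.le))
    (fun i => h₂ (x i) (hx0 i) (by rw [hxsq]; exact (hy _ (hmem i).2).2.1.le))
    (fun i => h₃ (x i) _ (hx0 i) (by rw [hxsq]; exact (hy _ (hmem i).2).2.2.1.le)
      (by linarith [hu2 i, min_le_left η₃ η₄]) (hu1 i))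
    (fun i => h₄ (x i) _ (hx0 i) (by rw [hxsq]; exact (hy _ (hmem i).2).2.2.2.1.le)
      (by linarith [hu2 i, min_le_right η₃ η₄]) (hu3 i) (hu1 i))
    (fun i => by
      have h5 : x i ^ 2 ≤ ε := by rw [hxsq]; exact (hy _ (hmem i).2).2.2.2.2.le
      have h6 : x i ^ 4 ≤ ε * x i ^ 2 := by nlinarith [sq_nonneg (x i)]
      linarith [Real.add_one_le_exp (ε * x i ^ 2)])
    (by rw [hSx]; exact hN1.le) (by rw [hSx]; exact hN2.le)
  rw [hSx] at key
  have hS0 : 0 ≤ S := Finset.sum_nonneg fun q _ => by positivity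
  have h5 : Real.exp S * Real.exp (κ / 2 * S) ≤ Real.exp ((1 / p + p / 4 - 5 * ε) * S) := by
    rw [← Real.exp_add, Real.exp_le_exp, hκ1]
    nlinarith
  have h6 : Real.log N ≤ C * Real.exp S := hlog N (by omega)
  -- `δ e^S ≥ η / C` by Euler's bound, so only the surplus `κ/2` remains, contradicting the choice
  -- of `N`.
  have h7 : η / C * Real.exp (κ / 2 * S) ≤ 8 * ‖T‖ := by
    refine le_trans ?_ key
    calc η / C * Real.exp (κ / 2 * S) ≤ δ * Real.exp S * Real.exp (κ / 2 * S) := by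
          gcongr
          rw [hδ, div_mul_eq_mul_div, div_le_div_iff₀ hC hlogN]
          nlinarith
      _ ≤ _ := by
          rw [mul_assoc]
          gcongr
  rw [div_lt_iff₀ hη0] at hN3
  rw [div_mul_eq_mul_div, div_le_iff₀ hC] at h7
  linarith
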